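/- **Setting.** Let $D=[0,1]^2\ni(t,x)$. For $q\in L^2([0,1])$ put $\eta(q)(x)=\exp\int_0^x q$, $\varphi(q)(x)=\int_0^x\eta(q)$ and $\langle f,g\rangle_\eta=\int_0^1\eta(q) f g\,dx$. Let $Q=\{q\in L^2([0,1]) : \int_0^1 q=0,\ \int_0^1\eta(q)=1\}$; via $q=\partial_x\log\partial_x\varphi$ this is the group $\mathrm{Diff}_0^2([0,1])$, and the right-invariant metric $\int_0^1 u''v''\,dx$ becomes $\int_0^1 X^2/\eta(q)\,dx$. Let $T_q^*Q=\{p\in L^2([0,1]):\langle p,1\rangle_\eta=\langle p,\varphi\rangle_\eta=0\}$. With $H_2=\begin{pmatrix}1&1/2\\1/2&1/3\end{pmatrix}$ set $$\pi_q^*(f)=f-\begin{bmatrix}1&\varphi\end{bmatrix}H_2^{-1}\begin{bmatrix}\langle f,1\rangle_\eta\\ \langle f,\varphi\rangle_\eta\end{bmatrix},\qquad \mathcal U(f,q)(x)=\tfrac12\int_x^1\eta(q)\,f\,dy$$ (with the same formula for $\mathcal U$ when $f\,dy$ is replaced by a measure, integrated over $[x,1]$), and $$\pi_1(p,q)=\begin{bmatrix}1&\varphi\end{bmatrix}H_2^{-1}\begin{bmatrix}0\\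 \tfrac32\int_0^1\eta(q)\left(\int_0^x\eta(q)p\right)^2dx\end{bmatrix},\qquad \pi_2(q,f)=(\mathrm{id}-\pi_q^*)\,\mathcal U(f,q).$$ For a curve $(p,q)$ in $T^*Q$ with $\dot q=\eta(q)p$, the acceleration covector is $\left(\frac{D}{Dt}\dot q\right)^\flat=\dot p+\mathcal U(p^2,q)-\pi_1(p,q)-\pi_2(q,p^2)$, and $(p,q)$ is a geodesic if it vanishes. Let $\mathcal C$ be the set of curves $(p,q)$ in $T^*Q$, $t\in[0,1]$, with $q\in H^2([0,1],L^2([0,1]))$ and $\dot q=\eta(q)p$. Let $\mathcal M_0(D)$ be the set of finite positive measures $\Delta$ on $D$ which vanish at $t=0$ and whose time derivative is a measure, in the sense that there is a finite signed measure $\partial_t\Delta$ on $D$ with $\langle\Delta,\partial_t f\rangle+\langle\partial_t\Delta,f\rangle=0$ for all $f\in C(D)$ with $\partial_tf\in C(D)$ and $f(1,\cdot)=0$ (for all other finite positive measures on $D$, $\mathcal F$ is $+\infty$). Let $\mathrm{FR}_f(\mu,\nu)=\int_D r\left(\frac{d\mu}{d\lambda},\frac{d\nu}{d\lambda}\right)f\,d\lambda$,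 where $\lambda$ is any finite measure dominating $\mu,\nu$, and $r(x,y)=\frac{y^2}{4x}$ if $x>0$, $r(0,0)=0$, $r=+\infty$ otherwise. For a penalty $P:L^2\times L^2\to\mathbb R$ and $\Delta=\int_0^1\Delta_t\,dt$, the relaxed functional is $$\mathcal F(\Delta,p,q)=\mathrm{FR}_{\eta(q)}(\Delta,\partial_t\Delta)+\int_0^1\!\!\int_0^1\eta(q)\left[\left(\tfrac{D}{Dt}\dot q\right)^\flat+\pi_q^*\big(\mathcal U(\Delta_t,q)\big)\right]^2dx\,dt+P(p(1),q(1))\in(-\infty,+\infty].$$ **Proposition.** There exists a geodesic $(p_0,q_0)$, defined for $t\in[0,\infty)$, starting at the identity ($q_0(0)=0$) with initial momentum $m_0=\delta_{1/4}-\delta_{3/4}$, that is, $\int_0^1p_0(0,x)\,h''(x)\,dx=h(\tfrac14)-h(\tfrac34)$ for all $h\in C^2$ with $h=h'=0$ at $0$ and $1$, for which the Jacobian $t\mapsto\eta(q_0(t))(\tfrac12)$ is strictly decreasing on $[0,\infty)$ and tends to $0$ as $t\to\infty$, and for which there is a smooth time reparametrization $\alpha$ (with $\alpha(0)=0$ and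 $\dot\alpha>0$ on $[0,1]$) such that the curve $(p(t),q(t))=(\dot\alpha(t)\,p_0(\alpha(t)),\,q_0(\alpha(t)))$, $t\in[0,1]$, belongs to $\mathcal C$ and, for every penalty $P$, $\Delta=0$ is not a minimizer of $\Delta\mapsto\mathcal F(\Delta,p,q)$ over $\mathcal M_0(D)$. -/

import Mathlib

open MeasureTheory Set Filter Topology
open scoped ENNReal ContDiff

noncomputable section

namespace DiffSpline

/-! ### The manifold `Q` of one-dimensional `H²₀` diffeomorphisms and its cotangent bundle -/

/-- Lebesgue measure on the space interval `[0,1]`. -/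
abbrev leb01 : Measure ℝ := volume.restrict (Icc (0 : ℝ) 1)

/-- The Hilbert space `L²([0,1])`. -/
abbrev L2 : Type := Lp ℝ 2 leb01

/-- `η(q)(x) = exp (∫₀ˣ q)`, the Jacobian `∂ₓφ` of the diffeomorphism `φ` with coordinate
`q = ∂ₓ log ∂ₓφ`. -/
def eta (q : L2) (x : ℝ) : ℝ := Real.exp (∫ u in (0 : ℝ)..x, q u)

/-- `φ(q)(x) = ∫₀ˣ η(q)`, the diffeomorphism itself. -/
def phi (q : L2) (x : ℝ) : ℝ := ∫ y in (0 : ℝ)..x, eta q y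

/-- The Hilbert submanifold `Q` of `L²([0,1])`. -/
def Q : Set L2 :=
  {q | ∫ x in (0 : ℝ)..1, q x = 0 ∧ ∫ x in (0 : ℝ)..1, eta q x = 1}

/-- The inner product `⟨f, g⟩_η = ∫₀¹ η(q) f g` of covectors at `q`. -/
def innerEta (q : L2) (f g : ℝ → ℝ) : ℝ := ∫ x in (0 : ℝ)..1, eta q x * f x * g x

/-- The cotangent space at `q`: those `p` for which `η(q) p` is tangent to `Q` at `q`, i.e.
`⟨p, 1⟩_η = 0` and `⟨p, φ⟩_η = 0`. -/
def cotangent (q : L2) : Set L2 :=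
  {p | innerEta q p (fun _ => 1) = 0 ∧ innerEta q p (phi q) = 0}

/-- The Hilbert matrix, which is the Gram matrix of `1, φ` for `⟨·,·⟩_η`. -/
def H2 : Matrix (Fin 2) (Fin 2) ℝ := !![1, 1 / 2; 1 / 2, 1 / 3]

/-- The function `[1 φ] H₂⁻¹ [a; b]`. -/
def gramComb (q : L2) (a b : ℝ) (x : ℝ) : ℝ :=
  dotProduct ![1, phi q x] (Matrix.mulVec H2⁻¹ ![a, b])

theorem H2_inv : H2⁻¹ = !![4, -6; -6, 12] := by
  apply Matrix.inv_eq_right_inv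
  ext i j
  fin_cases i <;> fin_cases j <;> norm_num [H2, Matrix.mul_apply, Fin.sum_univ_two]

theorem gramComb_eq (q : L2) (a b x : ℝ) :
    gramComb q a b x = (4 * a - 6 * b) + (12 * b - 6 * a) * phi q x := by
  rw [gramComb, H2_inv]
  simp [Matrix.mulVec, dotProduct, Fin.sum_univ_two]
  ring

/-- The projection `π_q^*` onto the cotangent space at `q`. -/
def projStar (q : L2) (f : ℝ → ℝ) (x : ℝ) : ℝ :=
  f x - gramComb q (innerEta q f (fun _ => 1)) (innerEta q f (phi q)) x

/-- The nonlocal operator `𝒰(f, q)(x) = ½ ∫ₓ¹ η(q) f` for a function `f`. -/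
def opU (f : ℝ → ℝ) (q : L2) (x : ℝ) : ℝ := (1 / 2) * ∫ y in x..1, eta q y * f y

/-- The nonlocal operator `𝒰(m, q)(x) = ½ ∫_{[x,1]} η(q) dm` for a measure `m`. -/
def opUMeas (m : Measure ℝ) (q : L2) (x : ℝ) : ℝ := (1 / 2) * ∫ y in Icc x 1, eta q y ∂m

/-- The coefficient `b = (3/2) ∫₀¹ (∫₀ˣ p ∘ φ⁻¹)² dx`, written in the variable `φ⁻¹(x)`. -/
def coeffB (p q : L2) : ℝ :=
  (3 / 2) * ∫ x in (0 : ℝ)..1, eta q x * (∫ y in (0 : ℝ)..x, eta q y * p y) ^ 2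

/-- `π₁(p, q) = [1 φ] H₂⁻¹ [0; b]`. -/
def pi1 (p q : L2) (x : ℝ) : ℝ := gramComb q 0 (coeffB p q) x

/-- `π₂(q, f) = (id - π_q^*)(𝒰(f, q))`. -/
def pi2 (q : L2) (f : ℝ → ℝ) (x : ℝ) : ℝ := opU f q x - projStar q (opU f q) x

/-- The covector `(D/Dt q̇)^♭ = ṗ + 𝒰(p², q) - π₁ - π₂` of the covariant acceleration of a curve,
computed from the values of `p`, `q` and `ṗ` (here `r`) at one time. -/
def accelFlat (p q r : L2) (x : ℝ) : ℝ :=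
  r x + opU (fun y => p y ^ 2) q x - pi1 p q x - pi2 q (fun y => p y ^ 2) x

/-! ### Geodesics -/

/-- `(p, q)` is a geodesic of `Q` on `[0, ∞)` in Hamiltonian coordinates: a curve in `T^*Q` with
`q̇ = η(q) p` and `ṗ = -½ ∫ₓ¹ η(q) p² + π₁ + π₂`, derivatives being taken in `L²([0,1])`. -/
structure IsGeodesic (p q : ℝ → L2) : Prop where
  mem_Q : ∀ t, 0 ≤ t → q t ∈ Q
  mem_cotangent : ∀ t, 0 ≤ t → p t ∈ cotangent (q t)
  velocity : ∀ t, 0 ≤ t → ∃ v : L2, HasDerivWithinAt q v (Ici 0) t ∧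
    ∀ᵐ x ∂leb01, v x = eta (q t) x * p t x
  momentum : ∀ t, 0 ≤ t → ∃ r : L2, HasDerivWithinAt p r (Ici 0) t ∧
    ∀ᵐ x ∂leb01, accelFlat (p t) (q t) r x = 0

/-- At the identity, where `p` is the second derivative `v''` of a vector field `v ∈ H²₀([0,1])`,
the momentum `m = L v ∈ H^{-2}`, given by `⟨m, h⟩ = ∫₀¹ v'' h''` for test functions `h` vanishing
to first order at `0` and `1`, is the sum of Dirac masses `∑ i, c i • δ_{y i}`. -/
def HasDiracMomentumAtId {n : ℕ} (p : L2) (c y : Fin n → ℝ) : Prop :=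
  p ∈ cotangent 0 ∧
  ∀ h : ℝ → ℝ, ContDiff ℝ 2 h → h 0 = 0 → h 1 = 0 → deriv h 0 = 0 → deriv h 1 = 0 →
    ∫ x in (0 : ℝ)..1, p x * deriv (deriv h) x = ∑ i, c i * h (y i)

/-- `(p, q)` is the landmark geodesic issued from the identity (`q = 0`) with initial momentum
`∑ i, c i • δ_{y i}`. -/
structure IsLandmarkGeodesic {n : ℕ} (c y : Fin n → ℝ) (p q : ℝ → L2) : Prop where
  geodesic : IsGeodesic p q
  start : q 0 = 0
  start_momentum : HasDiracMomentumAtId (p 0) c y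

/-! ### Curves of finite acceleration -/

/-- `u ∈ H¹([0,1], L²([0,1]))`, for the continuous representative. -/
def MemH1 (u : ℝ → L2) : Prop :=
  ∃ g : ℝ → L2, MemLp g 2 leb01 ∧ ∀ t ∈ Icc (0 : ℝ) 1, u t = u 0 + ∫ s in (0 : ℝ)..t, g s

/-- `u ∈ H²([0,1], L²([0,1]))`, for the `C¹` representative. -/
def MemH2 (u : ℝ → L2) : Prop :=
  ∃ v : ℝ → L2, MemH1 v ∧ ∀ t ∈ Icc (0 : ℝ) 1, HasDerivWithinAt u (v t) (Icc 0 1) t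

/-- The class `𝒞⁰` of curves in `T^*Q` over the time interval `[0,1]` with initial values
`(pi, qi)`. -/
structure IsCurve (pi qi : L2) (p q : ℝ → L2) : Prop where
  memH2 : MemH2 q
  mem_Q : ∀ t ∈ Icc (0 : ℝ) 1, q t ∈ Q
  mem_cotangent : ∀ t ∈ Icc (0 : ℝ) 1, p t ∈ cotangent (q t)
  velocity : ∀ t ∈ Icc (0 : ℝ) 1, ∃ v : L2, HasDerivWithinAt q v (Icc 0 1) t ∧
    ∀ᵐ x ∂leb01, v x = eta (q t) x * p t x
  start_p : p 0 = pi
  start_q : q 0 = qi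

/-- A smooth, strictly increasing time reparametrization `[0,1] → [0, α(1)]`. -/
structure IsTimeReparam (α : ℝ → ℝ) : Prop where
  smooth : ContDiff ℝ ∞ α
  start : α 0 = 0
  deriv_pos : ∀ t ∈ Icc (0 : ℝ) 1, 0 < deriv α t

/-! ### The Fisher-Rao functional -/

/-- The time-space square `D = [0,1]²`; points are `(t, x)`. -/
def D : Set (ℝ × ℝ) := Icc (0 : ℝ) 1 ×ˢ Icc (0 : ℝ) 1

/-- The one-homogeneous convex function `r`. -/
def frIntegrand (x y : ℝ) : ℝ≥0∞ :=
  if 0 < x then ENNReal.ofReal (1 / 4 * (y ^ 2 / x)) else if x = 0 ∧ y = 0 then 0 else ⊤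

/-- The Fisher-Rao functional `FR_f(μ, ν) = ∫ r(dμ/dλ, dν/dλ) f dλ`, for the dominating measure
`λ = μ + |ν|` (by one-homogeneity of `r`, its choice is immaterial). -/
def fisherRao (f : ℝ × ℝ → ℝ) (μ : Measure (ℝ × ℝ)) (ν : SignedMeasure (ℝ × ℝ)) : ℝ≥0∞ :=
  ∫⁻ z, frIntegrand (μ.rnDeriv (μ + ν.totalVariation) z).toReal
      (ν.rnDeriv (μ + ν.totalVariation) z) * ENNReal.ofReal (f z) ∂(μ + ν.totalVariation)

/-- `f ∈ C_{1,0}(D)`, with time derivative `ft`. -/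
structure IsC10 (f ft : ℝ × ℝ → ℝ) : Prop where
  cont : ContinuousOn f D
  cont_deriv : ContinuousOn ft D
  hasDeriv : ∀ t ∈ Icc (0 : ℝ) 1, ∀ x ∈ Icc (0 : ℝ) 1,
    HasDerivWithinAt (fun s => f (s, x)) (ft (t, x)) (Icc 0 1) t

/-- The signed measure `δ` on `D` is `∂_t Δ`, and `Δ` vanishes at time `0`, in the weak sense:
`⟨∂_t f, Δ⟩ + ⟨f, δ⟩ = 0` for all `f ∈ C_{1,0}(D)` with `f(1, ·) = 0`. -/
def IsTimeDeriv (Δ : Measure (ℝ × ℝ)) (δ : SignedMeasure (ℝ × ℝ)) : Prop :=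
  δ.totalVariation Dᶜ = 0 ∧
  ∀ f ft : ℝ × ℝ → ℝ, IsC10 f ft → (∀ x ∈ Icc (0 : ℝ) 1, f (1, x) = 0) →
    ∫ z, ft z ∂Δ + ∫ᵛ z, f z ∂<•δ = 0

/-- The positive finite measures `Δ` on `D` that vanish at time `0` and have a time derivative
which is a measure (all others have infinite relaxed energy). -/
def M0 : Set (FiniteMeasure (ℝ × ℝ)) :=
  {Δ | (Δ : Measure (ℝ × ℝ)) Dᶜ = 0 ∧ ∃ δ, IsTimeDeriv Δ δ}

/-! ### The relaxed functional -/

/-- The disintegration `Δ_t` of `Δ = ∫ Δ_t dt` at time `t`: the conditional measure at `t` times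
the density of the time marginal of `Δ`. -/
def slice (Δ : FiniteMeasure (ℝ × ℝ)) (t : ℝ) : Measure ℝ :=
  ((Δ : Measure (ℝ × ℝ)).fst.rnDeriv volume t) • (Δ : Measure (ℝ × ℝ)).condKernel t

/-- `FR_η(Δ, ∂_t Δ)`, equal to `+∞` if `∂_t Δ` is not a measure. (The weak equation determines
`∂_t Δ` up to a part carried by `{t = 1}`; a nonzero such part makes `FR_η` infinite, so that the
infimum is the value at the time derivative.) -/
def fisherRaoPath (q : ℝ → L2) (Δ : FiniteMeasure (ℝ × ℝ)) : ℝ≥0∞ :=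
  ⨅ (δ : SignedMeasure (ℝ × ℝ)) (_ : IsTimeDeriv Δ δ),
    fisherRao (fun z => eta (q z.1) z.2) Δ δ

/-- The relaxed functional, minimized over `ν`, as a function of the defect measure `Δ`:
`ℱ(Δ, p, q) = FR_η(Δ, ∂_t Δ) + ∫₀¹ ‖(D/Dt q̇)^♭ + π_q^*(𝒰(Δ, q))‖²_q dt + P(p(1), q(1))`,
where `‖f‖²_q = ∫₀¹ η(q) f²`. -/
def relaxedF (P : L2 → L2 → ℝ) (p q : ℝ → L2) (Δ : FiniteMeasure (ℝ × ℝ)) : EReal :=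
  ((fisherRaoPath q Δ + ∫⁻ t in Icc (0 : ℝ) 1, ∫⁻ x in Icc (0 : ℝ) 1,
      ENNReal.ofReal (eta (q t) x * (accelFlat (p t) (q t) (deriv p t) x +
        projStar (q t) (opUMeas (slice Δ t) (q t)) x) ^ 2) : ℝ≥0∞) : EReal) +
    ((P (p 1) (q 1) : ℝ) : EReal)

end DiffSpline

end

/-! The two landmarks attract each other symmetrically: they sit at `a` and `1 - a`, with opposite
momenta. The Eulerian velocity `V` is a cubic spline, antisymmetric about 1/2. The midpoint is
therefore fixed, and it is compressed at the rate `δ = -V'(1/2) = (3/4) k a²`. Conservation of the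
energy, proportional to `k² a³ (2 - a)`, reduces the motion to one scalar equation
(`exists_landmarks`). It shows that the landmarks never meet and that `δ` stays above a positive
constant for `t ≥ 0`. Hence the Jacobian `E = exp U(·, 1/2)` at the midpoint, which satisfies `E' =
-δ E`, decreases exponentially to 0.

The geodesic is built from the flow `φ` of `V`: `p = V'' ∘ φ`, and `q` is determined by `∫₀ˣ q = U`,
the logarithm of `∂ₓφ`. The geodesic equation holds up to an affine function of `φ` by a computation
with the spline (`exists_affine_fS`). The affine part is then fixed by differentiating the two
cotangent constraints in time (`accelFlat_geo`).

After a time change `α`, the acceleration covector is `α'' p₀(α)`, because the geodesic equation is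
quadratic in the momentum (`accelFlat_smul`). Test `Δ = 0` against the defect `ε α(t)² dt ⊗
δ_{1/2}`. Its Fisher-Rao cost is `ε ∫ α'² E(α) dt`. The cross term with the acceleration is `-ε ∫
α'' δ(α) α² E(α) dt`, which is negative where `α'' > 0`. All the rest is `O(ε²)`, and the penalty
sees only the endpoint of the curve, so it does not change.

It remains to choose `α` with negative first variation (`exists_expTime_neg`). For `α = A (exp (l t)
- 1)` one has `α' = l (α + A)` and `α'' = l α'`. Substituting `s = α(t)`, with `R = α(1)`, and
integrating by parts with `E' = -δ E`, the first variation becomes `l (E(R) R² + ∫₀ᴿ E(s) (A - s)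
ds)`. It is negative once `R` is so large that `E(R) R²` is small, and `A R` is small as well. -/

namespace DiffSpline

/-! ### Global solutions of ordinary differential equations -/

section ODE

open Metric
open scoped NNReal

variable {E : Type*} [NormedAddCommGroup E] [NormedSpace ℝ E]

/-- Two solutions with the same value at time `0` agree, if the vector field is Lipschitz on
balls, locally uniformly in time. -/
theorem ode_unique {F : ℝ → E → E}
    (hl : ∀ T R : ℝ, ∃ K : ℝ≥0, ∀ t ∈ Icc (-T) T, LipschitzOnWith K (F t) (closedBall 0 R))
    {f g : ℝ → E} {T : ℝ} (hf : ∀ t ∈ Ioo (-T) T, HasDerivAt f (F t (f t)) t)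
    (hg : ∀ t ∈ Ioo (-T) T, HasDerivAt g (F t (g t)) t) (h0 : f 0 = g 0) :
    EqOn f g (Ioo (-T) T) := by
  intro t ht
  obtain ⟨T', hT1, hT2⟩ := exists_between (abs_lt.2 ht)
  have hpos : 0 < T' := (abs_nonneg t).trans_lt hT1
  have hsub : Icc (-T') T' ⊆ Ioo (-T) T := fun s hs => ⟨by linarith [hs.1], by linarith [hs.2]⟩
  have bdd : ∀ h : ℝ → E, (∀ t ∈ Ioo (-T) T, HasDerivAt h (F t (h t)) t) →
      ∃ R, ∀ s ∈ Icc (-T') T', ‖h s‖ ≤ R := fun h hh =>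
    isCompact_Icc.exists_bound_of_continuousOn
      fun s hs => (hh s (hsub hs)).continuousAt.continuousWithinAt
  obtain ⟨R₁, hR₁⟩ := bdd f hf
  obtain ⟨R₂, hR₂⟩ := bdd g hg
  obtain ⟨K, hK⟩ := hl T' (max R₁ R₂)
  refine ODE_solution_unique_of_mem_Ioo (v := F) (s := fun _ => closedBall 0 (max R₁ R₂))
    (K := K) (a := -T') (b := T') (t₀ := 0)
    (fun s hs => hK s (Ioo_subset_Icc_self hs)) ⟨by linarith, hpos⟩ (fun s hs => ?_)
    (fun s hs => ?_) h0 (abs_lt.1 hT1)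
  · exact ⟨hf s (hsub (Ioo_subset_Icc_self hs)),
      mem_closedBall_zero_iff.2 ((hR₁ s (Ioo_subset_Icc_self hs)).trans (le_max_left _ _))⟩
  · exact ⟨hg s (hsub (Ioo_subset_Icc_self hs)),
      mem_closedBall_zero_iff.2 ((hR₂ s (Ioo_subset_Icc_self hs)).trans (le_max_right _ _))⟩

theorem ode_unique_univ {F : ℝ → E → E}
    (hl : ∀ T R : ℝ, ∃ K : ℝ≥0, ∀ t ∈ Icc (-T) T, LipschitzOnWith K (F t) (closedBall 0 R))
    {f g : ℝ → E} (hf : ∀ t, HasDerivAt f (F t (f t)) t)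
    (hg : ∀ t, HasDerivAt g (F t (g t)) t) (h0 : f 0 = g 0) : f = g := by
  ext t
  exact ode_unique hl (T := |t| + 1) (fun s _ => hf s) (fun s _ => hg s) h0
    (abs_lt.1 (lt_add_one _))

/-- Global existence for a bounded vector field which is Lipschitz on balls, locally uniformly in
time. -/
theorem exists_global_solution [CompleteSpace E] {F : ℝ → E → E} (x₀ : E)
    (hb : ∀ T : ℝ, ∃ L : ℝ≥0, ∀ t ∈ Icc (-T) T, ∀ x, ‖F t x‖ ≤ L)
    (hl : ∀ T R : ℝ, ∃ K : ℝ≥0, ∀ t ∈ Icc (-T) T, LipschitzOnWith K (F t) (closedBall 0 R))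
    (hc : ∀ x, Continuous fun t => F t x) :
    ∃ u : ℝ → E, u 0 = x₀ ∧ ∀ t, HasDerivAt u (F t (u t)) t := by
  have loc : ∀ n : ℕ, ∃ u : ℝ → E, u 0 = x₀ ∧
      ∀ t ∈ Ioo (-(n : ℝ)) n, HasDerivAt u (F t (u t)) t := by
    intro n
    have hn : (0 : ℝ) ≤ n := n.cast_nonneg
    obtain ⟨L, hL⟩ := hb n
    obtain ⟨K, hK⟩ := hl n (‖x₀‖ + L * n)
    -- A field bounded by `L` moves a point by at most `L * n` in time `n`, so the ball of that
    -- radius suffices and Picard-Lindelöf covers the whole interval at once.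
    have hP : IsPicardLindelof F (tmin := -(n : ℝ)) (tmax := n) ⟨0, by simp, hn⟩ x₀
        (L * n) 0 L K := by
      refine ⟨fun t ht => (hK t ht).mono ?_, fun x _ => (hc x).continuousOn,
        fun t ht x _ => hL t ht x, ?_⟩
      · refine closedBall_subset_closedBall' ?_
        simp [add_comm]
      · simp
    obtain ⟨u, hu0, hu⟩ := hP.exists_eq_forall_mem_Icc_hasDerivWithinAt₀
    exact ⟨u, hu0, fun t ht => (hu t (Ioo_subset_Icc_self ht)).hasDerivAt
      (Icc_mem_nhds ht.1 ht.2)⟩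
  choose u hu0 hu using loc
  have agree : ∀ m n : ℕ, m ≤ n → EqOn (u m) (u n) (Ioo (-(m : ℝ)) m) := fun m n hmn =>
    ode_unique hl (hu m) (fun t ht => hu n t
      ⟨by linarith [ht.1, (Nat.cast_le (α := ℝ)).2 hmn],
        by linarith [ht.2, (Nat.cast_le (α := ℝ)).2 hmn]⟩) (by rw [hu0, hu0])
  let N : ℝ → ℕ := fun t => ⌈|t|⌉₊ + 1
  have hN : ∀ t, t ∈ Ioo (-(N t : ℝ)) (N t) := fun t => by
    have := Nat.le_ceil |t|
    exact abs_lt.1 (by push_cast [N]; linarith)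
  have key : ∀ t (n : ℕ), t ∈ Ioo (-(n : ℝ)) n → u (N t) t = u n t := fun t n ht => by
    rcases le_total (N t) n with h | h
    · exact agree _ _ h (hN t)
    · exact (agree _ _ h ht).symm
  refine ⟨fun t => u (N t) t, hu0 _, fun t => ?_⟩
  refine (hu (N t) t (hN t)).congr_of_eventuallyEq ?_
  filter_upwards [isOpen_Ioo.mem_nhds (hN t)] with s hs using key s _ hs

end ODE

/-! ### Functions depending continuously on a parameter -/

section Param

theorem eventually_forall_Icc_dist_lt {f : ℝ → ℝ → ℝ} (hf : Continuous (Function.uncurry f))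
    (t a b : ℝ) {ε : ℝ} (hε : 0 < ε) :
    ∀ᶠ s in 𝓝 t, ∀ x ∈ Icc a b, |f s x - f t x| < ε := by
  obtain ⟨v, hv, h⟩ := IsCompact.mem_uniformity_of_prod (s := univ) (k := Icc a b) isCompact_Icc
    hf.continuousOn (mem_univ t) (Metric.dist_mem_uniformity hε)
  rw [nhdsWithin_univ] at hv
  filter_upwards [hv] with s hs x hx
  exact h s hs x hx

theorem exists_bound_Icc_prod {f : ℝ → ℝ → ℝ} (hf : Continuous (Function.uncurry f))
    (T a b : ℝ) : ∃ M : ℝ, 0 ≤ M ∧ ∀ t ∈ Icc (-T) T, ∀ x ∈ Icc a b, |f t x| ≤ M := by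
  obtain ⟨M, hM⟩ := (isCompact_Icc.prod isCompact_Icc).exists_bound_of_continuousOn
    (s := Icc (-T) T ×ˢ Icc a b) hf.continuousOn
  exact ⟨max M 0, le_max_right _ _, fun t ht x hx => (hM (t, x) ⟨ht, hx⟩).trans (le_max_left _ _)⟩

theorem hasDerivAt_integral_param {f f' : ℝ → ℝ → ℝ} (hf : Continuous (Function.uncurry f))
    (hf' : Continuous (Function.uncurry f')) {x : ℝ} (hx : 0 ≤ x)
    (h : ∀ t, ∀ y ∈ Icc 0 x, HasDerivAt (fun s => f s y) (f' t y) t) (t : ℝ) :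
    HasDerivAt (fun s => ∫ y in (0 : ℝ)..x, f s y) (∫ y in (0 : ℝ)..x, f' t y) t := by
  have hc : ∀ s, Continuous (f s) := fun s => hf.comp (by fun_prop : Continuous fun y => (s, y))
  have hc' : ∀ s, Continuous (f' s) := fun s => hf'.comp (by fun_prop : Continuous fun y => (s, y))
  obtain ⟨M, -, hM⟩ := exists_bound_Icc_prod hf' (|t| + 1) 0 x
  refine (intervalIntegral.hasDerivAt_integral_of_dominated_loc_of_deriv_le (bound := fun _ => M)
    (s := Ioo (-(|t| + 1)) (|t| + 1))
    (isOpen_Ioo.mem_nhds (abs_lt.1 (lt_add_one _)))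
    (Eventually.of_forall fun s => (hc s).aestronglyMeasurable)
    ((hc t).intervalIntegrable _ _) (hc' t).aestronglyMeasurable ?_ (by simp) ?_).2
  · refine ae_of_all _ fun y hy s hs => ?_
    rw [uIoc_of_le hx] at hy
    exact hM s (Ioo_subset_Icc_self hs) y (Ioc_subset_Icc_self hy)
  · refine ae_of_all _ fun y hy s _ => ?_
    rw [uIoc_of_le hx] at hy
    exact h s y (Ioc_subset_Icc_self hy)

end Param

/-! ### Continuous functions as elements of `L²` -/

section ToL2

/-- The class in `L²([0,1])` of a square-integrable function (`0` for other functions). -/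
noncomputable def toL2 (f : ℝ → ℝ) : L2 :=
  open Classical in if h : MemLp f 2 leb01 then h.toLp f else 0

theorem memLp_of_continuous {f : ℝ → ℝ} (hf : Continuous f) : MemLp f 2 leb01 := by
  obtain ⟨M, hM⟩ := isCompact_Icc.exists_bound_of_continuousOn (s := Icc (0 : ℝ) 1) hf.continuousOn
  exact MemLp.of_bound hf.aestronglyMeasurable M
    ((ae_restrict_iff' measurableSet_Icc).2 (ae_of_all _ hM))

theorem coeFn_toL2 {f : ℝ → ℝ} (hf : Continuous f) : toL2 f =ᵐ[leb01] f := by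
  rw [toL2, dif_pos (memLp_of_continuous hf)]
  exact MemLp.coeFn_toLp _

/-- The interval has mass one, so the sup norm dominates the L² norm. Every L² limit below is
obtained from a uniform one in this way. -/
theorem norm_L2_le {u : L2} {M : ℝ} (hM : 0 ≤ M) (h : ∀ᵐ x ∂leb01, |u x| ≤ M) : ‖u‖ ≤ M := by
  have := Lp.norm_le_of_ae_bound (f := u) hM h
  simpa [measureUnivNNReal] using this

theorem ae_leb01 {p : ℝ → Prop} (h : ∀ x ∈ Icc (0 : ℝ) 1, p x) : ∀ᵐ x ∂leb01, p x :=
  (ae_restrict_iff' measurableSet_Icc).2 (ae_of_all _ h)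

theorem continuous_toL2 {f : ℝ → ℝ → ℝ} (hf : Continuous (Function.uncurry f)) :
    Continuous fun t => toL2 (f t) := by
  have hc : ∀ s, Continuous (f s) := fun s => hf.comp (by fun_prop : Continuous fun y => (s, y))
  refine continuous_iff_continuousAt.2 fun t => Metric.tendsto_nhds.2 fun ε hε => ?_
  filter_upwards [eventually_forall_Icc_dist_lt hf t 0 1 (half_pos hε)] with s hs
  rw [dist_eq_norm]
  refine (norm_L2_le (half_pos hε).le ?_).trans_lt (half_lt_self hε)
  filter_upwards [Lp.coeFn_sub (toL2 (f s)) (toL2 (f t)), coeFn_toL2 (hc s), coeFn_toL2 (hc t),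
    ae_leb01 hs] with x h1 h2 h3 h4
  rw [h1, Pi.sub_apply, h2, h3]
  exact h4.le

theorem hasDerivAt_toL2 {f f' : ℝ → ℝ → ℝ} (hf : Continuous (Function.uncurry f))
    (hf' : Continuous (Function.uncurry f'))
    (h : ∀ t, ∀ x ∈ Icc (0 : ℝ) 1, HasDerivAt (fun s => f s x) (f' t x) t) (t : ℝ) :
    HasDerivAt (fun s => toL2 (f s)) (toL2 (f' t)) t := by
  have hc : ∀ s, Continuous (f s) := fun s => hf.comp (by fun_prop : Continuous fun y => (s, y))
  have hc' : ∀ s, Continuous (f' s) := fun s => hf'.comp (by fun_prop : Continuous fun y => (s, y))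
  rw [hasDerivAt_iff_isLittleO, Asymptotics.isLittleO_iff]
  intro ε hε
  obtain ⟨δ, hδ, hball⟩ := Metric.eventually_nhds_iff_ball.1
    (eventually_forall_Icc_dist_lt hf' t 0 1 hε)
  filter_upwards [Metric.ball_mem_nhds t hδ] with s hs
  refine norm_L2_le (by positivity) ?_
  filter_upwards [Lp.coeFn_sub (toL2 (f s) - toL2 (f t)) ((s - t) • toL2 (f' t)),
    Lp.coeFn_sub (toL2 (f s)) (toL2 (f t)), Lp.coeFn_smul (s - t) (toL2 (f' t)),
    coeFn_toL2 (hc s), coeFn_toL2 (hc t), coeFn_toL2 (hc' t),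
    ae_restrict_mem measurableSet_Icc] with x h1 h2 h3 h4 h5 h6 hx
  rw [h1, Pi.sub_apply, h2, Pi.sub_apply, h3, Pi.smul_apply, h4, h5, h6, smul_eq_mul]
  -- Mean value inequality for the remainder `r ↦ f r x - r * f' t x`. Its derivative is at most `ε`
  -- on the ball, uniformly in `x`.
  have := (convex_ball t δ).norm_image_sub_le_of_norm_hasDerivWithin_le
    (f := fun r => f r x - r * f' t x) (f' := fun r => f' r x - 1 * f' t x) (C := ε)
    (fun r _ => ((h r x hx).sub ((hasDerivAt_id r).mul_const _)).hasDerivWithinAt)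
    (fun r hr => by simpa using (hball r hr x hx).le) (Metric.mem_ball_self hδ) hs
  simp only [Real.norm_eq_abs] at this ⊢
  convert this using 2
  ring

end ToL2

end DiffSpline

namespace DiffSpline

/-! ### The Eulerian vector field of the symmetric two-landmark geodesic

The landmarks sit at `a` and `1 - a`; `k` is proportional to the momentum times `1 / 2 - a`. -/

section Field

/-- If the derivative of `f` vanishes at `a`, then `f` can be frozen to the left of `a`. -/
theorem hasDerivAt_comp_max {f f' : ℝ → ℝ} (hf : ∀ x, HasDerivAt f (f' x) x) {a : ℝ}
    (ha : f' a = 0) (y : ℝ) : HasDerivAt (fun y => f (max y a)) (f' (max y a)) y := by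
  rcases lt_trichotomy y a with h | rfl | h
  · rw [max_eq_right h.le, ha]
    refine (hasDerivAt_const y (f a)).congr_of_eventuallyEq ?_
    filter_upwards [Iio_mem_nhds h] with z hz
    rw [max_eq_right (le_of_lt hz)]
  · rw [max_self, ← hasDerivWithinAt_univ, ← Iic_union_Ici (a := y)]
    refine HasDerivWithinAt.union ?_ ?_
    · rw [ha]
      exact (hasDerivWithinAt_const y _ (f y)).congr
        (fun z hz => by rw [max_eq_right (show z ≤ y from hz)]) (by simp)
    · exact (hf y).hasDerivWithinAt.congr
        (fun z hz => by rw [max_eq_left (show y ≤ z from hz)]) (by simp)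
  · rw [max_eq_left h.le]
    refine (hf y).congr_of_eventuallyEq ?_
    filter_upwards [Ioi_mem_nhds h] with z hz
    rw [max_eq_left (le_of_lt hz)]

/-- If the derivative of `f` vanishes at `a`, then `f` can be frozen to the right of `a`. -/
theorem hasDerivAt_comp_min {f f' : ℝ → ℝ} (hf : ∀ x, HasDerivAt f (f' x) x) {a : ℝ}
    (ha : f' a = 0) (y : ℝ) : HasDerivAt (fun y => f (min y a)) (f' (min y a)) y := by
  have h1 : ∀ x, HasDerivAt (fun x => f (-x)) (-f' (-x)) x := fun x => by
    have := (hf (-x)).scomp x (hasDerivAt_neg x)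
    rw [neg_one_smul] at this
    exact this
  have h2 := hasDerivAt_comp_max h1 (a := -a) (by simp [ha]) (-y)
  have h3 := h2.scomp y (hasDerivAt_neg y)
  have e : ∀ y, -max (-y) (-a) = min y a := fun y => by rw [max_neg_neg, neg_neg]
  simpa [Function.comp_def, e] using h3

/-- Second derivative of the field at `0`, up to the factor `2`. -/
noncomputable def fB (a k : ℝ) : ℝ := 3 / 2 * k * a * (1 - a)

/-- Third derivative of the field at `0`, up to the factor `-6`. -/
noncomputable def fG (a k : ℝ) : ℝ := k * (1 / 2 + a - a ^ 2)

/-- The momentum of the left landmark. -/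
noncomputable def fM (a k : ℝ) : ℝ := 3 * k / (2 * (1 / 2 - a))

/-- The second derivative of the field. -/
noncomputable def fW (a k y : ℝ) : ℝ :=
  2 * fB a k - 6 * fG a k * y + fM a k * (max y a - a) - fM a k * (max y (1 - a) - (1 - a))

/-- The first derivative of the field. -/
noncomputable def fV1 (a k y : ℝ) : ℝ :=
  2 * fB a k * y - 3 * fG a k * y ^ 2 + fM a k / 2 * (max y a - a) ^ 2 -
    fM a k / 2 * (max y (1 - a) - (1 - a)) ^ 2

/-- The field. -/
noncomputable def fV (a k y : ℝ) : ℝ :=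
  fB a k * y ^ 2 - fG a k * y ^ 3 + fM a k / 6 * (max y a - a) ^ 3 -
    fM a k / 6 * (max y (1 - a) - (1 - a)) ^ 3

/-- The exponent is at least 2, so the derivative vanishes at the knot `b` and the truncated power
is differentiable there. -/
theorem hasDerivAt_max_sub_pow (b : ℝ) (n : ℕ) (y : ℝ) :
    HasDerivAt (fun y => (max y b - b) ^ (n + 2)) ((n + 2) * (max y b - b) ^ (n + 1)) y := by
  refine hasDerivAt_comp_max (f := fun y => (y - b) ^ (n + 2))
    (f' := fun y => (n + 2) * (y - b) ^ (n + 1)) (fun x => ?_) (by simp) y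
  have := ((hasDerivAt_id x).sub_const b).fun_pow (n + 2)
  simpa using this

theorem hasDerivAt_fV1 (a k y : ℝ) : HasDerivAt (fV1 a k) (fW a k y) y := by
  have h1 := hasDerivAt_max_sub_pow a 0 y
  have h2 := hasDerivAt_max_sub_pow (1 - a) 0 y
  have h := (((((hasDerivAt_id y).const_mul (2 * fB a k)).sub
    (((hasDerivAt_id y).pow 2).const_mul (3 * fG a k))).add (h1.const_mul (fM a k / 2))).sub
    (h2.const_mul (fM a k / 2)))
  refine (h.congr_of_eventuallyEq (Eventually.of_forall fun z => ?_)).congr_deriv ?_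
  · simp [fV1]
  · simp [fW]; ring

theorem hasDerivAt_fV (a k y : ℝ) : HasDerivAt (fV a k) (fV1 a k y) y := by
  have h1 := hasDerivAt_max_sub_pow a 1 y
  have h2 := hasDerivAt_max_sub_pow (1 - a) 1 y
  have h := ((((((hasDerivAt_id y).pow 2).const_mul (fB a k)).sub
    (((hasDerivAt_id y).pow 3).const_mul (fG a k))).add (h1.const_mul (fM a k / 6))).sub
    (h2.const_mul (fM a k / 6)))
  refine (h.congr_of_eventuallyEq (Eventually.of_forall fun z => ?_)).congr_deriv ?_
  · simp [fV]
  · simp [fV1]; ring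

variable {a k : ℝ}

/-- The momentum `fM` is singular at collision and `k` is its regular rescaling. This relation is
the only fact about `fM` that the evaluations below need. -/
theorem fM_mul (ha : a < 1 / 2) : fM a k * (1 / 2 - a) = 3 / 2 * k := by
  have : (1 / 2 - a) ≠ 0 := by linarith
  rw [fM, div_mul_eq_mul_div, div_eq_iff (by simpa using this)]; ring

theorem fV1_zero (h0 : 0 < a) (ha : a < 1 / 2) : fV1 a k 0 = 0 := by
  rw [fV1, max_eq_right h0.le, max_eq_right (by linarith)]; ring

theorem fV_zero (h0 : 0 < a) (ha : a < 1 / 2) : fV a k 0 = 0 := by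
  rw [fV, max_eq_right h0.le, max_eq_right (by linarith)]; ring

/-- The coefficients `fB` and `fG` are the solution of the two clamping conditions at 1; those at 0
are built into the form of the spline. -/
theorem fV1_one (h0 : 0 < a) (ha : a < 1 / 2) : fV1 a k 1 = 0 := by
  rw [fV1, max_eq_left (by linarith), max_eq_left (by linarith), fB, fG]
  linear_combination fM_mul (k := k) ha

theorem fV_one (h0 : 0 < a) (ha : a < 1 / 2) : fV a k 1 = 0 := by
  rw [fV, max_eq_left (by linarith), max_eq_left (by linarith), fB, fG]
  linear_combination (1 - a + a ^ 2) / 3 * fM_mul (k := k) ha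

/-- This is the compression rate at the midpoint. It governs both the decay of the Jacobian and the
sign of the first variation. -/
theorem fV1_half (ha : a < 1 / 2) : fV1 a k (1 / 2) = -(3 / 4) * k * a ^ 2 := by
  rw [fV1, max_eq_left (by linarith), max_eq_right (by linarith), fB, fG]
  linear_combination (1 / 2 - a) / 2 * fM_mul (k := k) ha

theorem fV_half (ha : a < 1 / 2) : fV a k (1 / 2) = 0 := by
  rw [fV, max_eq_left (by linarith), max_eq_right (by linarith), fB, fG]
  linear_combination (1 / 2 - a) ^ 2 / 6 * fM_mul (k := k) ha

/-- Velocity of the left landmark. -/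
noncomputable def fA' (a k : ℝ) : ℝ := k * a ^ 3 * (1 / 2 - a) * (2 - a)

/-- Time derivative of `k`. -/
noncomputable def fK' (a k : ℝ) : ℝ := -2 * k ^ 2 * (1 / 2 - a) * a ^ 2 * (3 / 2 - a)

theorem fV_left (ha : a < 1 / 2) : fV a k a = fA' a k := by
  rw [fV, max_self, max_eq_right (by linarith), fB, fG, fA']
  ring

theorem fV_right (ha : a < 1 / 2) : fV a k (1 - a) = -fA' a k := by
  rw [fV, max_self, max_eq_left (by linarith), fB, fG, fA']
  linear_combination (4 / 3 * (1 / 2 - a) ^ 2) * fM_mul (k := k) ha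

theorem fV1_left (ha : a < 1 / 2) :
    fV1 a k a = k * a ^ 2 * (3 / 2 - 6 * a + 3 * a ^ 2) := by
  rw [fV1, max_self, max_eq_right (by linarith), fB, fG]
  ring

theorem fV1_right (ha : a < 1 / 2) :
    fV1 a k (1 - a) = k * a ^ 2 * (3 / 2 - 6 * a + 3 * a ^ 2) := by
  rw [fV1, max_self, max_eq_left (by linarith), fB, fG]
  linear_combination (2 * (1 / 2 - a)) * fM_mul (k := k) ha

/-- The material derivative of `fW`. -/
noncomputable def fS (a k y : ℝ) : ℝ :=
  2 * (3 / 2 * (fK' a k * a * (1 - a) + k * fA' a k * (1 - 2 * a))) -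
    6 * (fK' a k * (1 / 2 + a - a ^ 2) + k * fA' a k * (1 - 2 * a)) * y - 6 * fG a k * fV a k y +
    (fM a k * (fV a k (max y a) - fV a k a) - fM a k * fV1 a k a * (max y a - a)) -
    (fM a k * (fV a k (max y (1 - a)) - fV a k (1 - a)) -
      fM a k * fV1 a k (1 - a) * (max y (1 - a) - (1 - a)))

/-- In `fS` each kink term is corrected by its tangent line at the knot, so that `fS` is
differentiable across the knots. The correction encodes the momentum equation `M' = -M V'` at a
landmark. -/
theorem hasDerivAt_fS (a k y : ℝ) : HasDerivAt (fS a k)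
    (-6 * (fK' a k * (1 / 2 + a - a ^ 2) + k * fA' a k * (1 - 2 * a)) - 6 * fG a k * fV1 a k y +
      (fM a k * fV1 a k (max y a) - fM a k * fV1 a k a) -
      (fM a k * fV1 a k (max y (1 - a)) - fM a k * fV1 a k (1 - a))) y := by
  have h : ∀ b, HasDerivAt (fun y => fM a k * (fV a k (max y b) - fV a k b) -
      fM a k * fV1 a k b * (max y b - b)) (fM a k * fV1 a k (max y b) - fM a k * fV1 a k b) y := by
    intro b
    refine hasDerivAt_comp_max (f := fun y => fM a k * (fV a k y - fV a k b) -
      fM a k * fV1 a k b * (y - b)) (f' := fun y => fM a k * fV1 a k y - fM a k * fV1 a k b)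
      (fun x => ?_) (by simp) y
    simpa using (((hasDerivAt_fV a k x).sub_const _).const_mul (fM a k)).fun_sub
      (((hasDerivAt_id x).sub_const b).const_mul (fM a k * fV1 a k b))
  have := (((((hasDerivAt_const y
    (2 * (3 / 2 * (fK' a k * a * (1 - a) + k * fA' a k * (1 - 2 * a))))).sub ((hasDerivAt_id y).const_mul
    (6 * (fK' a k * (1 / 2 + a - a ^ 2) + k * fA' a k * (1 - 2 * a))))).sub
    ((hasDerivAt_fV a k y).const_mul (6 * fG a k))).add (h a)).sub (h (1 - a)))
  exact this.congr_deriv (by ring)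

theorem continuous_fW (a k : ℝ) : Continuous (fW a k) := by
  unfold fW; fun_prop

/-- The geodesic equation up to affine functions. -/
theorem exists_affine_fS (ha : a < 1 / 2) : ∃ c d : ℝ, ∀ y,
    fS a k y + (1 / 2) * ∫ s in y..1, fW a k s ^ 2 = c + d * y := by
  have hc : Continuous fun s => fW a k s ^ 2 := (continuous_fW a k).pow 2
  -- The slope is read off at `y = 0`, where `fV1` vanishes and `fW` equals `2 * fB`.
  set e : ℝ := -6 * (fK' a k * (1 / 2 + a - a ^ 2) + k * fA' a k * (1 - 2 * a)) - 2 * fB a k ^ 2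
  have key : ∀ y, HasDerivAt
      (fun y => fS a k y - (1 / 2) * (∫ s in (0 : ℝ)..y, fW a k s ^ 2) - e * y) 0 y := by
    intro y
    have h := ((hasDerivAt_fS a k y).sub ((hc.integral_hasStrictDerivAt 0 y).hasDerivAt.const_mul
      (1 / 2))).sub ((hasDerivAt_id y).const_mul e)
    refine h.congr_deriv ?_
    -- Between knots `fW` is affine with a constant slope `m`, and `m V' - V''² / 2` has derivative
    -- `m V'' - V'' m = 0`. Explicit formulas on the three pieces show that the constant is the same
    -- on each.
    rcases le_total y a with h1 | h1
    · have h2 : y ≤ 1 - a := by linarith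
      simp only [fV1, fW, max_eq_right h1, max_eq_right h2, max_self,
        max_eq_right (show a ≤ 1 - a by linarith), max_eq_left (show a ≤ 1 - a by linarith), e]
      ring
    · rcases le_total y (1 - a) with h2 | h2
      · simp only [fV1, fW, max_eq_left h1, max_eq_right h2, max_self,
          max_eq_right (show a ≤ 1 - a by linarith), max_eq_left (show a ≤ 1 - a by linarith), e]
        ring
      · simp only [fV1, fW, max_eq_left h1, max_eq_left h2, max_self,
          max_eq_right (show a ≤ 1 - a by linarith), max_eq_left (show a ≤ 1 - a by linarith), e]
        ring
  have hconst := is_const_of_deriv_eq_zero (fun y => (key y).differentiableAt)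
    (fun y => (key y).deriv)
  refine ⟨fS a k 0 + (1 / 2) * ∫ s in (0 : ℝ)..1, fW a k s ^ 2, e, fun y => ?_⟩
  have h0 := hconst y 0
  have hi := intervalIntegral.integral_add_adjacent_intervals (hc.intervalIntegrable 0 y)
    (hc.intervalIntegrable y 1) (μ := volume)
  simp only [intervalIntegral.integral_same] at h0
  linear_combination h0 + (1 / 2) * hi

end Field

end DiffSpline

namespace DiffSpline

/-! ### The trajectory of the landmarks -/

section Landmarks

/-- Right-hand side of the scalar equation for `w`, where `a = 2 / ((√3 + exp w) ^ 2 + 1)`. -/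
noncomputable def wField (w : ℝ) : ℝ :=
  -(√7 / 192) * ((2 * √3 + Real.exp w) / ((√3 + Real.exp w) ^ 2 + 1))

theorem contDiff_wField : ContDiff ℝ 1 wField := by
  unfold wField
  refine contDiff_const.mul (ContDiff.div ?_ ?_ fun x => by positivity)
  · exact contDiff_const.add Real.contDiff_exp
  · exact ((contDiff_const.add Real.contDiff_exp).pow 2).add contDiff_const

theorem wField_nonpos (w : ℝ) : wField w ≤ 0 := by
  have : 0 ≤ √7 / 192 * ((2 * √3 + Real.exp w) / ((√3 + Real.exp w) ^ 2 + 1)) := by positivity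
  rw [wField]; linarith

theorem norm_wField_le (w : ℝ) : ‖wField w‖ ≤ √7 / 192 := by
  have h3 : √3 ^ 2 = 3 := Real.sq_sqrt (by norm_num)
  have h31 : (1 : ℝ) ≤ √3 := Real.one_le_sqrt.2 (by norm_num)
  have h32 : √3 ≤ 2 := by nlinarith
  have he := Real.exp_pos w
  have h : (2 * √3 + Real.exp w) / ((√3 + Real.exp w) ^ 2 + 1) ≤ 1 := by
    rw [div_le_one (by positivity)]
    nlinarith
  rw [Real.norm_eq_abs, abs_of_nonpos (wField_nonpos w), wField, neg_mul, neg_neg]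
  exact mul_le_of_le_one_right (by positivity) h

/-- With `z = √3 + exp w`, the value `z = √3` corresponds to collision at `a = 1/2` and `z = √7` to
`a = 1/4`. The logarithmic variable makes collision unreachable, and its field is bounded, so the
solution is global. -/
theorem exists_w : ∃ w : ℝ → ℝ, w 0 = Real.log (√7 - √3) ∧ ∀ t, HasDerivAt w (wField (w t)) t := by
  refine exists_global_solution (F := fun _ => wField) _
    (fun T => ⟨⟨√7 / 192, by positivity⟩, fun t _ x => norm_wField_le x⟩) (fun T R => ?_)
    (fun x => continuous_const)
  obtain ⟨K, hK⟩ := LocallyLipschitzOn.exists_lipschitzOnWith_of_compact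
    (isCompact_closedBall (0 : ℝ) R) (contDiff_wField.locallyLipschitz.locallyLipschitzOn)
  exact ⟨K, fun _ _ => hK⟩

/-- The Hamiltonian system of the two landmarks has a global solution. -/
theorem exists_landmarks : ∃ a k : ℝ → ℝ, (∀ t, HasDerivAt a (fA' (a t) (k t)) t) ∧
    (∀ t, HasDerivAt k (fK' (a t) (k t)) t) ∧ (∀ t, 0 < a t) ∧ (∀ t, a t < 1 / 2) ∧
    (∀ t, 0 < k t) ∧ a 0 = 1 / 4 ∧ k 0 = 1 / 6 ∧
    ∃ c > 0, ∀ t, 0 ≤ t → c ≤ k t * a t ^ 2 := by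
  obtain ⟨w, hw0, hw⟩ := exists_w
  have h3 : √3 ^ 2 = 3 := Real.sq_sqrt (by norm_num)
  have h7 : √7 ^ 2 = 7 := Real.sq_sqrt (by norm_num)
  have h3p : 0 < √3 := by positivity
  have h7p : 0 < √7 := by positivity
  -- Here `z² = 2/a - 1`. Conservation of `k² a³ (2 - a)` says that `k a² z` is constant. The
  -- initial data `a = 1/4`, `k = 1/6` give the constant `√7 / 96`, which determines `k` from `z`.
  set z : ℝ → ℝ := fun t => √3 + Real.exp (w t)
  have hz3 : ∀ t, √3 < z t := fun t => lt_add_of_pos_right _ (Real.exp_pos _)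
  have hzp : ∀ t, 0 < z t := fun t => h3p.trans (hz3 t)
  have hz0 : z 0 = √7 := by
    have : √3 < √7 := Real.sqrt_lt_sqrt (by norm_num) (by norm_num)
    simp only [z]
    rw [hw0, Real.exp_log (by linarith)]; ring
  have hz : ∀ t, HasDerivAt z (-(√7 / 192) * ((z t ^ 2 - 3) / (z t ^ 2 + 1))) t := fun t => by
    refine ((hw t).exp.const_add _).congr_deriv ?_
    simp only [z]
    rw [wField]
    field_simp
    linear_combination h3
  have hzanti : Antitone z := antitone_of_hasDerivAt_nonpos hz fun t => by
    have : 0 ≤ (z t ^ 2 - 3) / (z t ^ 2 + 1) :=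
      div_nonneg (by nlinarith [hz3 t]) (by positivity)
    have : 0 ≤ √7 / 192 * ((z t ^ 2 - 3) / (z t ^ 2 + 1)) := by positivity
    simp only [Pi.zero_apply]
    linarith
  refine ⟨fun t => 2 / (z t ^ 2 + 1), fun t => √7 / 96 * (z t ^ 2 + 1) ^ 2 / (4 * z t),
    fun t => ?_, fun t => ?_, fun t => by positivity, fun t => ?_,
    fun t => by have := hzp t; positivity, ?_, ?_, √7 / 96 / √7, by positivity, fun t ht => ?_⟩
  · have hp := hzp t
    refine ((hasDerivAt_const t 2).fun_div (((hz t).fun_pow 2).add_const 1)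
      (by positivity)).congr_deriv ?_
    rw [fA']
    field_simp
    ring
  · have hp := hzp t
    refine ((((((hz t).fun_pow 2).add_const 1).fun_pow 2).const_mul (√7 / 96)).fun_div
      ((hz t).const_mul 4) (by positivity)).congr_deriv ?_
    rw [fK']
    field_simp
    ring
  · rw [div_lt_div_iff₀ (by positivity) (by norm_num)]
    nlinarith [hz3 t]
  · simp only [hz0, h7]; norm_num
  · simp only [hz0, h7]; field_simp; norm_num
  · have hp := hzp t
    -- Since `z` decreases, `k a²` is smallest at time 0 among nonnegative times.
    have : √7 / 96 * (z t ^ 2 + 1) ^ 2 / (4 * z t) * (2 / (z t ^ 2 + 1)) ^ 2 = √7 / 96 / z t := by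
      field_simp
      ring
    rw [this]
    have := hzanti ht
    rw [hz0] at this
    gcongr

end Landmarks

end DiffSpline

namespace DiffSpline

/-! ### The flow of a time-dependent vector field on `[0,1]` -/

section Flow

open Metric
open scoped NNReal

/-- The projection of the line onto `[0,1]`. -/
noncomputable def clamp (y : ℝ) : ℝ := max (min y 1) 0

theorem clamp_mem (y : ℝ) : clamp y ∈ Icc (0 : ℝ) 1 :=
  ⟨le_max_right _ _, max_le (min_le_right _ _) zero_le_one⟩

theorem clamp_of_mem {y : ℝ} (hy : y ∈ Icc (0 : ℝ) 1) : clamp y = y := by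
  rw [clamp, min_eq_left hy.2, max_eq_left hy.1]

theorem continuous_clamp : Continuous clamp := by unfold clamp; fun_prop

theorem abs_clamp_sub_le (y z : ℝ) : |clamp y - clamp z| ≤ |y - z| := by
  refine (abs_max_sub_max_le_max _ _ _ _).trans ?_
  rw [sub_self, abs_zero, max_eq_left (abs_nonneg _)]
  refine (abs_min_sub_min_le_max _ _ _ _).trans ?_
  rw [sub_self, abs_zero, max_eq_left (abs_nonneg _)]

theorem hasDerivAt_comp_clamp {f f' : ℝ → ℝ} (hf : ∀ x, HasDerivAt f (f' x) x) (h0 : f' 0 = 0)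
    (h1 : f' 1 = 0) (y : ℝ) : HasDerivAt (fun y => f (clamp y)) (f' (clamp y)) y :=
  hasDerivAt_comp_min (f := fun y => f (max y 0)) (f' := fun y => f' (max y 0))
    (hasDerivAt_comp_max hf h0) (by rw [max_eq_left zero_le_one, h1]) y

theorem lipschitz_comp_clamp {f f' : ℝ → ℝ → ℝ} (hf' : Continuous (Function.uncurry f'))
    (h : ∀ t y, HasDerivAt (f t) (f' t y) y) (T : ℝ) : ∃ M : ℝ, 0 ≤ M ∧ ∀ t ∈ Icc (-T) T,
      ∀ y z, |f t (clamp y) - f t (clamp z)| ≤ M * |y - z| := by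
  obtain ⟨M, hM0, hM⟩ := exists_bound_Icc_prod hf' T 0 1
  refine ⟨M, hM0, fun t ht y z => ?_⟩
  have := (convex_Icc (0 : ℝ) 1).norm_image_sub_le_of_norm_hasDerivWithin_le
    (fun x _ => (h t x).hasDerivWithinAt) (fun x hx => hM t ht x hx) (clamp_mem z) (clamp_mem y)
  exact this.trans (mul_le_mul_of_nonneg_left (abs_clamp_sub_le y z) hM0)

theorem abs_exp_sub_exp_le {x y R : ℝ} (hx : |x| ≤ R) (hy : |y| ≤ R) :
    |Real.exp x - Real.exp y| ≤ Real.exp R * |x - y| :=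
  (convex_Icc (-R) R).norm_image_sub_le_of_norm_hasDerivWithin_le
    (fun z _ => (Real.hasDerivAt_exp z).hasDerivWithinAt)
    (fun z hz => by
      rw [Real.norm_eq_abs, Real.abs_exp]; exact Real.exp_le_exp.2 hz.2) (abs_le.1 hy) (abs_le.1 hx)

/-- Extension of a continuous function on `[0,1]` by constants. -/
noncomputable def ext01 (u : C(Icc (0 : ℝ) 1, ℝ)) (y : ℝ) : ℝ := u (projIcc 0 1 zero_le_one y)

theorem continuous_ext01 (u : C(Icc (0 : ℝ) 1, ℝ)) : Continuous (ext01 u) :=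
  u.continuous.comp continuous_projIcc

theorem ext01_sub_le (u v : C(Icc (0 : ℝ) 1, ℝ)) (y : ℝ) : |ext01 u y - ext01 v y| ≤ ‖u - v‖ :=
  (u - v).norm_coe_le_norm _

theorem continuous_primitive_exp_ext01 (u : C(Icc (0 : ℝ) 1, ℝ)) :
    Continuous fun x => ∫ y in (0 : ℝ)..x, Real.exp (ext01 u y) :=
  intervalIntegral.continuous_primitive
    (fun _ _ => (Real.continuous_exp.comp (continuous_ext01 u)).intervalIntegrable _ _) 0

/-- The vector field driving the logarithmic Jacobian of the flow. -/
noncomputable def logJacField (v : ℝ → ℝ → ℝ) (hv : ∀ t, Continuous (v t)) (t : ℝ)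
    (u : C(Icc (0 : ℝ) 1, ℝ)) : C(Icc (0 : ℝ) 1, ℝ) where
  toFun x := v t (clamp (∫ y in (0 : ℝ)..x, Real.exp (ext01 u y)))
  continuous_toFun := (hv t).comp (continuous_clamp.comp
    ((continuous_primitive_exp_ext01 u).comp continuous_subtype_val))

/-- The unknown of the differential equation is the logarithmic Jacobian, in the Banach space of
continuous functions on `[0,1]`, and the flow is recovered as the primitive of its exponential. The
Jacobian is then positive by construction, and the flow need not be differentiated in its initial
condition. The clamp makes the field bounded. -/
theorem exists_logJac {v w : ℝ → ℝ → ℝ} (hv : Continuous (Function.uncurry v))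
    (hw : Continuous (Function.uncurry w)) (hvw : ∀ t y, HasDerivAt (v t) (w t y) y) :
    ∃ U : ℝ → ℝ → ℝ, Continuous (Function.uncurry U) ∧ (∀ x, U 0 x = 0) ∧
      ∀ t, ∀ x ∈ Icc (0 : ℝ) 1, HasDerivAt (fun s => U s x)
        (v t (clamp (∫ y in (0 : ℝ)..x, Real.exp (U t y)))) t := by
  have hv1 : ∀ t, Continuous (v t) := fun t => hv.comp (by fun_prop : Continuous fun y => (t, y))
  have hb : ∀ T : ℝ, ∃ L : ℝ≥0, ∀ t ∈ Icc (-T) T, ∀ u, ‖logJacField v hv1 t u‖ ≤ L := by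
    intro T
    obtain ⟨M, hM0, hM⟩ := exists_bound_Icc_prod hv T 0 1
    exact ⟨⟨M, hM0⟩, fun t ht u => (ContinuousMap.norm_le _ hM0).2
      fun x => hM t ht _ (clamp_mem _)⟩
  have hl : ∀ T R : ℝ, ∃ K : ℝ≥0, ∀ t ∈ Icc (-T) T,
      LipschitzOnWith K (logJacField v hv1 t) (closedBall 0 R) := by
    intro T R
    obtain ⟨M, hM0, hM⟩ := lipschitz_comp_clamp hw hvw T
    have hMR : 0 ≤ M * Real.exp R := by positivity
    refine ⟨(M * Real.exp R).toNNReal, fun t ht => LipschitzOnWith.of_dist_le_mul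
      fun u hu u' hu' => ?_⟩
    rw [ContinuousMap.dist_le (by positivity), Real.coe_toNNReal _ hMR]
    intro x
    refine (hM t ht _ _).trans ?_
    rw [mul_assoc]
    refine mul_le_mul_of_nonneg_left ?_ hM0
    have hint : ∀ u : C(Icc (0 : ℝ) 1, ℝ), IntervalIntegrable (fun y => Real.exp (ext01 u y))
        volume 0 x := fun u =>
      (Real.continuous_exp.comp (continuous_ext01 u)).intervalIntegrable _ _
    rw [← intervalIntegral.integral_sub (hint u) (hint u')]
    have hb : ∀ u ∈ closedBall (0 : C(Icc (0 : ℝ) 1, ℝ)) R, ∀ y, |ext01 u y| ≤ R :=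
      fun u hu y => (u.norm_coe_le_norm _).trans (mem_closedBall_zero_iff.1 hu)
    have := intervalIntegral.norm_integral_le_of_norm_le_const (a := 0) (b := (x : ℝ))
      (C := Real.exp R * dist u u')
      (f := fun y => Real.exp (ext01 u y) - Real.exp (ext01 u' y)) fun y _ => by
        refine (abs_exp_sub_exp_le (hb u hu y) (hb u' hu' y)).trans ?_
        rw [dist_eq_norm]
        exact mul_le_mul_of_nonneg_left (ext01_sub_le u u' y) (Real.exp_pos _).le
    refine this.trans (mul_le_of_le_one_right (by positivity) ?_)
    rw [sub_zero, abs_of_nonneg x.2.1]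
    exact x.2.2
  have hcont : ∀ u, Continuous fun t => logJacField v hv1 t u := by
    intro u
    refine ContinuousMap.continuous_of_continuous_uncurry _ ?_
    exact hv.comp (continuous_fst.prodMk (continuous_clamp.comp
      ((continuous_primitive_exp_ext01 u).comp (continuous_subtype_val.comp continuous_snd))))
  obtain ⟨u, hu0, hu⟩ := exists_global_solution (F := logJacField v hv1) 0 hb hl hcont
  refine ⟨fun t => ext01 (u t), ?_, fun x => ?_, fun t x hx => ?_⟩
  · have huc : Continuous u := continuous_iff_continuousAt.2 fun t => (hu t).continuousAt
    have : Continuous fun p : ℝ × ℝ => (u p.1) (projIcc 0 1 zero_le_one p.2) :=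
      (huc.comp continuous_fst).eval (continuous_projIcc.comp continuous_snd)
    exact this
  · simp [ext01, hu0]
  · have h := (ContinuousMap.evalCLM ℝ (⟨x, hx⟩ : Icc (0 : ℝ) 1)).hasFDerivAt.comp_hasDerivAt t
      (hu t)
    have e : ∀ s, ext01 (u s) x = (u s) ⟨x, hx⟩ := fun s => by
      rw [ext01, projIcc_of_mem _ hx]
    simp only [e]
    exact h

/-- The flow `φ` of the vector field `V` on `[0,1]` and its logarithmic Jacobian `U`. -/
structure IsFlow (V v : ℝ → ℝ → ℝ) (U φ : ℝ → ℝ → ℝ) : Prop where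
  continuous_U : Continuous (Function.uncurry U)
  continuous_phi : Continuous (Function.uncurry φ)
  U_zero : ∀ x, U 0 x = 0
  phi_zero : ∀ x, φ 0 x = x
  phi_left : ∀ t, φ t 0 = 0
  phi_right : ∀ t, φ t 1 = 1
  phi_mem : ∀ t, ∀ x ∈ Icc (0 : ℝ) 1, φ t x ∈ Icc (0 : ℝ) 1
  hasDerivAt_space : ∀ t x, HasDerivAt (φ t) (Real.exp (U t x)) x
  hasDerivAt_U : ∀ t, ∀ x ∈ Icc (0 : ℝ) 1, HasDerivAt (fun s => U s x) (v t (φ t x)) t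
  hasDerivAt_phi : ∀ t, ∀ x ∈ Icc (0 : ℝ) 1, HasDerivAt (fun s => φ s x) (V t (φ t x)) t
  unique : ∀ f : ℝ → ℝ, (∀ t, HasDerivAt f (V t (f t)) t) → (∀ t, f t ∈ Icc (0 : ℝ) 1) →
    ∀ t, φ t (f 0) = f t

/-- Differentiating `φ = ∫ exp U` in time gives the integral of `∂ₓ (V ∘ clamp ∘ φ)`, hence the flow
equation for the clamped field; `v = 0` at both ends makes `V ∘ clamp` differentiable. The constant
path 1 is a solution, so by uniqueness `φ t 1 = 1`. By monotonicity `φ` then stays in `[0,1]`, where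
the clamp does nothing. -/
theorem exists_isFlow {V v w : ℝ → ℝ → ℝ}
    (hv : Continuous (Function.uncurry v))
    (hw : Continuous (Function.uncurry w)) (hVv : ∀ t y, HasDerivAt (V t) (v t y) y)
    (hvw : ∀ t y, HasDerivAt (v t) (w t y) y) (hv0 : ∀ t, v t 0 = 0) (hv1 : ∀ t, v t 1 = 0)
    (hV0 : ∀ t, V t 0 = 0) (hV1 : ∀ t, V t 1 = 0) : ∃ U φ, IsFlow V v U φ := by
  obtain ⟨U, hUc, hU0, hU⟩ := exists_logJac hv hw hvw
  have hc : ∀ s, Continuous fun y => Real.exp (U s y) := fun s =>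
    Real.continuous_exp.comp (hUc.comp (by fun_prop : Continuous fun y => (s, y)))
  set φ : ℝ → ℝ → ℝ := fun t x => ∫ y in (0 : ℝ)..x, Real.exp (U t y) with hφ
  have hexpc : Continuous (Function.uncurry fun s y => Real.exp (U s y)) :=
    Real.continuous_exp.comp hUc
  have hφc : Continuous (Function.uncurry φ) := by
    have := intervalIntegral.continuous_parametric_intervalIntegral_of_continuous
      (f := fun (p : ℝ × ℝ) y => Real.exp (U p.1 y)) (a₀ := 0) (s := fun p => p.2) (μ := volume)
      (hexpc.comp ((continuous_fst.comp continuous_fst).prodMk continuous_snd)) continuous_snd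
    exact this
  have hspace : ∀ t x, HasDerivAt (φ t) (Real.exp (U t x)) x := fun t x =>
    ((hc t).integral_hasStrictDerivAt 0 x).hasDerivAt
  have hleft : ∀ t, φ t 0 = 0 := fun t => intervalIntegral.integral_same
  have htime : ∀ t, ∀ x ∈ Icc (0 : ℝ) 1, HasDerivAt (fun s => φ s x) (V t (clamp (φ t x))) t := by
    intro t x hx
    have hpath : Continuous (Function.uncurry fun s y => Real.exp (U s y) * v s (clamp (φ s y))) :=
      hexpc.mul (hv.comp (continuous_fst.prodMk (continuous_clamp.comp hφc)))
    refine (hasDerivAt_integral_param hexpc hpath hx.1 (fun s y hy => ?_) t).congr_deriv ?_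
    · exact (hU s y ⟨hy.1, hy.2.trans hx.2⟩).exp
    · have := intervalIntegral.integral_eq_sub_of_hasDerivAt (a := 0) (b := x)
        (f := fun y => V t (clamp (φ t y)))
        (f' := fun y => Real.exp (U t y) * v t (clamp (φ t y))) (fun y _ => ?_)
        ((hpath.comp (by fun_prop : Continuous fun y => (t, y))).intervalIntegrable _ _)
      · rw [this, hleft, clamp_of_mem (y := 0) (by simp), hV0, sub_zero]
      · have := (hasDerivAt_comp_clamp (hVv t) (hv0 t) (hv1 t) (φ t y)).comp y (hspace t y)
        exact this.congr_deriv (mul_comm _ _)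
  have hlip : ∀ T R : ℝ, ∃ K : ℝ≥0, ∀ t ∈ Icc (-T) T,
      LipschitzOnWith K (fun y => V t (clamp y)) (closedBall 0 R) := fun T R => by
    obtain ⟨M, hM0, hM⟩ := lipschitz_comp_clamp hv hVv T
    exact ⟨⟨M, hM0⟩, fun t ht => LipschitzOnWith.of_dist_le_mul fun y _ z _ => hM t ht y z⟩
  have hφ0 : ∀ x, φ 0 x = x := fun x => by simp [hφ, hU0]
  have huniq : ∀ f : ℝ → ℝ, (∀ t, HasDerivAt f (V t (f t)) t) → (∀ t, f t ∈ Icc (0 : ℝ) 1) →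
      ∀ t, φ t (f 0) = f t := fun f hf hfm t =>
    congrFun (ode_unique_univ hlip (f := fun t => φ t (f 0)) (htime · _ (hfm 0))
      (fun t => by rw [clamp_of_mem (hfm t)]; exact hf t) (hφ0 _)) t
  have hright : ∀ t, φ t 1 = 1 := huniq (fun _ => 1)
    (fun t => by rw [hV1]; exact hasDerivAt_const _ _) (fun t => by simp)
  have hmono : ∀ t, Monotone (φ t) := fun t =>
    monotone_of_hasDerivAt_nonneg (hspace t) fun x => (Real.exp_pos _).le
  have hmem : ∀ t, ∀ x ∈ Icc (0 : ℝ) 1, φ t x ∈ Icc (0 : ℝ) 1 := fun t x hx =>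
    ⟨(hleft t).symm.le.trans (hmono t hx.1), (hmono t hx.2).trans (hright t).le⟩
  refine ⟨U, φ, hUc, hφc, hU0, hφ0, hleft, hright, hmem, hspace, fun t x hx => ?_,
    fun t x hx => ?_, huniq⟩
  · have := hU t x hx
    rwa [show (∫ y in (0 : ℝ)..x, Real.exp (U t y)) = φ t x from rfl,
      clamp_of_mem (hmem t x hx)] at this
  · have := htime t x hx
    rwa [clamp_of_mem (hmem t x hx)] at this

end Flow

end DiffSpline

namespace DiffSpline

/-! ### The symmetric two-landmark geodesic -/

section Geodesic

/-- The flow `φ`, with logarithmic Jacobian `U`, of the two-landmark vector field along a solution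
`(a, k)` of the Hamiltonian system of the landmarks. -/
structure IsLandmarkFlow (a k : ℝ → ℝ) (U φ : ℝ → ℝ → ℝ) : Prop where
  hasDerivAt_a : ∀ t, HasDerivAt a (fA' (a t) (k t)) t
  hasDerivAt_k : ∀ t, HasDerivAt k (fK' (a t) (k t)) t
  a_pos : ∀ t, 0 < a t
  a_lt : ∀ t, a t < 1 / 2
  k_pos : ∀ t, 0 < k t
  a_zero : a 0 = 1 / 4
  k_zero : k 0 = 1 / 6
  bound : ∃ c > 0, ∀ t, 0 ≤ t → c ≤ k t * a t ^ 2
  flow : IsFlow (fun t => fV (a t) (k t)) (fun t => fV1 (a t) (k t)) U φ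

theorem continuous_fM {a k : ℝ → ℝ} (ha : Continuous a) (hk : Continuous k)
    (h : ∀ t, a t < 1 / 2) : Continuous fun t => fM (a t) (k t) := by
  unfold fM
  exact (continuous_const.mul hk).div (by fun_prop) fun t => by have := h t; intro h0; linarith

section Continuity

variable {a k : ℝ → ℝ} (ha : Continuous a) (hk : Continuous k) (h : ∀ t, a t < 1 / 2)
include ha hk h

theorem continuous_uncurry_fW : Continuous (Function.uncurry fun t => fW (a t) (k t)) := by
  have hM := (continuous_fM ha hk h).comp (continuous_fst (X := ℝ) (Y := ℝ))
  have e : (Function.uncurry fun t => fW (a t) (k t)) = fun p : ℝ × ℝ => fW (a p.1) (k p.1) p.2 :=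
    rfl
  rw [e]
  simp only [fW, fB, fG, Function.comp_def] at hM ⊢
  fun_prop

theorem continuous_uncurry_fV1 : Continuous (Function.uncurry fun t => fV1 (a t) (k t)) := by
  have hM := (continuous_fM ha hk h).comp (continuous_fst (X := ℝ) (Y := ℝ))
  have e : (Function.uncurry fun t => fV1 (a t) (k t)) =
    fun p : ℝ × ℝ => fV1 (a p.1) (k p.1) p.2 := rfl
  rw [e]
  simp only [fV1, fB, fG, Function.comp_def] at hM ⊢
  fun_prop

theorem continuous_uncurry_fV : Continuous (Function.uncurry fun t => fV (a t) (k t)) := by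
  have hM := (continuous_fM ha hk h).comp (continuous_fst (X := ℝ) (Y := ℝ))
  have e : (Function.uncurry fun t => fV (a t) (k t)) =
    fun p : ℝ × ℝ => fV (a p.1) (k p.1) p.2 := rfl
  rw [e]
  simp only [fV, fB, fG, Function.comp_def] at hM ⊢
  fun_prop

theorem continuous_uncurry_fS : Continuous (Function.uncurry fun t => fS (a t) (k t)) := by
  have hM := (continuous_fM ha hk h).comp (continuous_fst (X := ℝ) (Y := ℝ))
  have hV := continuous_uncurry_fV ha hk h
  have hV1 := continuous_uncurry_fV1 ha hk h
  have e : (Function.uncurry fun t => fS (a t) (k t)) =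
    fun p : ℝ × ℝ => fS (a p.1) (k p.1) p.2 := rfl
  have hVc : ∀ g : ℝ × ℝ → ℝ, Continuous g → Continuous fun p : ℝ × ℝ => fV (a p.1) (k p.1) (g p) :=
    fun g hg => hV.comp (continuous_fst.prodMk hg)
  have hV1c : ∀ g : ℝ × ℝ → ℝ, Continuous g →
      Continuous fun p : ℝ × ℝ => fV1 (a p.1) (k p.1) (g p) :=
    fun g hg => hV1.comp (continuous_fst.prodMk hg)
  have h1 := hVc (fun p => p.2) (by fun_prop)
  have h2 := hVc (fun p => a p.1) (by fun_prop)
  have h3 := hVc (fun p => 1 - a p.1) (by fun_prop)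
  have h4 := hVc (fun p => max p.2 (a p.1)) (by fun_prop)
  have h5 := hVc (fun p => max p.2 (1 - a p.1)) (by fun_prop)
  have h6 := hV1c (fun p => a p.1) (by fun_prop)
  have h7 := hV1c (fun p => 1 - a p.1) (by fun_prop)
  rw [e]
  simp only [fS, fG, fA', fK', Function.comp_def] at hM ⊢
  fun_prop

end Continuity

theorem exists_isLandmarkFlow : ∃ a k U φ, IsLandmarkFlow a k U φ := by
  obtain ⟨a, k, ha, hk, ha0, ha1, hk0, ha00, hk00, hb⟩ := exists_landmarks
  have hac : Continuous a := continuous_iff_continuousAt.2 fun t => (ha t).continuousAt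
  have hkc : Continuous k := continuous_iff_continuousAt.2 fun t => (hk t).continuousAt
  obtain ⟨U, φ, h⟩ := exists_isFlow (V := fun t => fV (a t) (k t))
    (continuous_uncurry_fV1 hac hkc ha1) (continuous_uncurry_fW hac hkc ha1)
    (fun t y => hasDerivAt_fV _ _ y) (fun t y => hasDerivAt_fV1 _ _ y)
    (fun t => fV1_zero (ha0 t) (ha1 t)) (fun t => fV1_one (ha0 t) (ha1 t))
    (fun t => fV_zero (ha0 t) (ha1 t)) (fun t => fV_one (ha0 t) (ha1 t))
  exact ⟨a, k, U, φ, ha, hk, ha0, ha1, hk0, ha00, hk00, hb, h⟩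

variable {a k : ℝ → ℝ} {U φ : ℝ → ℝ → ℝ}

/-- The momentum covector along the flow, as a function of time and label. -/
noncomputable def flowP (a k : ℝ → ℝ) (φ : ℝ → ℝ → ℝ) (t x : ℝ) : ℝ := fW (a t) (k t) (φ t x)

/-- The time derivative of `flowP`. -/
noncomputable def flowR (a k : ℝ → ℝ) (φ : ℝ → ℝ → ℝ) (t x : ℝ) : ℝ := fS (a t) (k t) (φ t x)

/-- The velocity of the coordinate `q` along the flow. -/
noncomputable def flowQ' (a k : ℝ → ℝ) (U φ : ℝ → ℝ → ℝ) (t x : ℝ) : ℝ :=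
  Real.exp (U t x) * flowP a k φ t x

/-- The coordinate `q` of the flow. -/
noncomputable def flowQ (a k : ℝ → ℝ) (U φ : ℝ → ℝ → ℝ) (t x : ℝ) : ℝ :=
  ∫ s in (0 : ℝ)..t, flowQ' a k U φ s x

/-- The curve of covectors of the geodesic. -/
noncomputable def geoP (a k : ℝ → ℝ) (φ : ℝ → ℝ → ℝ) (t : ℝ) : L2 := toL2 (flowP a k φ t)

/-- The curve of base points of the geodesic. -/
noncomputable def geoQ (a k : ℝ → ℝ) (U φ : ℝ → ℝ → ℝ) (t : ℝ) : L2 := toL2 (flowQ a k U φ t)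

theorem slice_continuous {f : ℝ → ℝ → ℝ} (hf : Continuous (Function.uncurry f)) (t : ℝ) :
    Continuous (f t) := hf.comp (by fun_prop : Continuous fun y => (t, y))

theorem integral_congr_leb01 {f g : ℝ → ℝ} (h : f =ᵐ[leb01] g) {x y : ℝ} (hx : x ∈ Icc (0 : ℝ) 1)
    (hy : y ∈ Icc (0 : ℝ) 1) : ∫ s in x..y, f s = ∫ s in x..y, g s := by
  refine intervalIntegral.integral_congr_ae ?_
  filter_upwards [(ae_restrict_iff' measurableSet_Icc).1 h] with s hs hm
  exact hs (uIcc_subset_Icc hx hy (uIoc_subset_uIcc hm))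

theorem integral_congr_Icc {f g : ℝ → ℝ} (h : ∀ s ∈ Icc (0 : ℝ) 1, f s = g s) {x y : ℝ}
    (hx : x ∈ Icc (0 : ℝ) 1) (hy : y ∈ Icc (0 : ℝ) 1) : ∫ s in x..y, f s = ∫ s in x..y, g s :=
  integral_congr_leb01 (ae_leb01 h) hx hy

namespace IsLandmarkFlow

variable (h : IsLandmarkFlow a k U φ)
include h

theorem continuous_a : Continuous a :=
  continuous_iff_continuousAt.2 fun t => (h.hasDerivAt_a t).continuousAt

theorem continuous_k : Continuous k :=
  continuous_iff_continuousAt.2 fun t => (h.hasDerivAt_k t).continuousAt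

/-- The landmark path is an integral curve of the field, so uniqueness identifies it with the flow
line through its initial point. The same argument applies to the other landmark and to the midpoint.
-/
theorem phi_quarter (t : ℝ) : φ t (1 / 4) = a t := by
  have := h.flow.unique a (fun t => by rw [fV_left (h.a_lt t)]; exact h.hasDerivAt_a t)
    (fun t => ⟨(h.a_pos t).le, by linarith [h.a_lt t]⟩) t
  rwa [h.a_zero] at this

theorem phi_three_quarters (t : ℝ) : φ t (3 / 4) = 1 - a t := by
  have := h.flow.unique (fun t => 1 - a t)
    (fun t => by rw [fV_right (h.a_lt t)]; exact (h.hasDerivAt_a t).const_sub 1)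
    (fun t => ⟨by linarith [h.a_lt t], by linarith [h.a_pos t]⟩) t
  rwa [h.a_zero, show (1 : ℝ) - 1 / 4 = 3 / 4 by norm_num] at this

theorem phi_half (t : ℝ) : φ t (1 / 2) = 1 / 2 :=
  h.flow.unique (fun _ => 1 / 2)
    (fun t => by rw [fV_half (h.a_lt t)]; exact hasDerivAt_const _ _)
    (fun t => by constructor <;> norm_num) t

theorem continuous_flowP : Continuous (Function.uncurry (flowP a k φ)) :=
  (continuous_uncurry_fW h.continuous_a h.continuous_k h.a_lt).comp
    (continuous_fst.prodMk h.flow.continuous_phi)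

theorem continuous_flowV1 :
    Continuous (Function.uncurry fun t x => fV1 (a t) (k t) (φ t x)) :=
  (continuous_uncurry_fV1 h.continuous_a h.continuous_k h.a_lt).comp
    (continuous_fst.prodMk h.flow.continuous_phi)

theorem continuous_flowV :
    Continuous (Function.uncurry fun t x => fV (a t) (k t) (φ t x)) :=
  (continuous_uncurry_fV h.continuous_a h.continuous_k h.a_lt).comp
    (continuous_fst.prodMk h.flow.continuous_phi)

theorem continuous_flowR : Continuous (Function.uncurry (flowR a k φ)) :=
  (continuous_uncurry_fS h.continuous_a h.continuous_k h.a_lt).comp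
    (continuous_fst.prodMk h.flow.continuous_phi)

theorem continuous_exp_U : Continuous (Function.uncurry fun t x => Real.exp (U t x)) :=
  Real.continuous_exp.comp h.flow.continuous_U

theorem continuous_flowQ' : Continuous (Function.uncurry (flowQ' a k U φ)) :=
  h.continuous_exp_U.mul h.continuous_flowP

theorem continuous_flowQ : Continuous (Function.uncurry (flowQ a k U φ)) := by
  have := intervalIntegral.continuous_parametric_intervalIntegral_of_continuous
    (f := fun (p : ℝ × ℝ) s => flowQ' a k U φ s p.2) (a₀ := 0) (s := fun p => p.1) (μ := volume)
    (h.continuous_flowQ'.comp (continuous_snd.prodMk (continuous_snd.comp continuous_fst)))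
    continuous_fst
  exact this

theorem hasDerivAt_flowQ (t x : ℝ) :
    HasDerivAt (fun s => flowQ a k U φ s x) (flowQ' a k U φ t x) t :=
  ((h.continuous_flowQ'.comp (by fun_prop : Continuous fun s => (s, x))).integral_hasStrictDerivAt
    0 t).hasDerivAt

theorem monotone_phi (t : ℝ) : Monotone (φ t) :=
  monotone_of_hasDerivAt_nonneg (h.flow.hasDerivAt_space t) fun _ => (Real.exp_pos _).le

/-- A label never crosses a landmark: as `φ` is monotone, the maximum of two flow lines is the flow
line of the larger label. The kinks of `fW` therefore do not spoil time differentiability along the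
flow. -/
theorem hasDerivAt_max_phi {x y : ℝ} (hx : x ∈ Icc (0 : ℝ) 1) (hy : y ∈ Icc (0 : ℝ) 1) (t : ℝ) :
    HasDerivAt (fun s => max (φ s x) (φ s y) - φ s y)
      (fV (a t) (k t) (max (φ t x) (φ t y)) - fV (a t) (k t) (φ t y)) t := by
  have hm : max x y ∈ Icc (0 : ℝ) 1 := ⟨hx.1.trans (le_max_left _ _), max_le hx.2 hy.2⟩
  simp only [← (h.monotone_phi _).map_max]
  exact (h.flow.hasDerivAt_phi t _ hm).sub (h.flow.hasDerivAt_phi t y hy)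

/-- Hamilton's equation for the momentum of the left landmark; `fK'` is this equation rewritten for
`k`. -/
theorem hasDerivAt_fM (t : ℝ) : HasDerivAt (fun s => fM (a s) (k s))
    (-fM (a t) (k t) * fV1 (a t) (k t) (a t)) t := by
  have h1 : 1 / 2 - a t ≠ 0 := by have := h.a_lt t; intro h0; linarith
  have h2 : 1 - 2 * a t ≠ 0 := by have := h.a_lt t; intro h0; linarith
  refine (((h.hasDerivAt_k t).const_mul 3).fun_div (((h.hasDerivAt_a t).const_sub (1 / 2)).const_mul
    2) (by positivity)).congr_deriv ?_
  rw [fV1_left (h.a_lt t), fM, fA', fK']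
  field_simp
  ring

theorem hasDerivAt_flowP (t : ℝ) {x : ℝ} (hx : x ∈ Icc (0 : ℝ) 1) :
    HasDerivAt (fun s => flowP a k φ s x) (flowR a k φ t x) t := by
  have ha := h.hasDerivAt_a t
  have hk := h.hasDerivAt_k t
  have hM := h.hasDerivAt_fM t
  have h1 := h.hasDerivAt_max_phi hx (y := 1 / 4) (by constructor <;> norm_num) t
  have h2 := h.hasDerivAt_max_phi hx (y := 3 / 4) (by constructor <;> norm_num) t
  simp only [h.phi_quarter] at h1
  simp only [h.phi_three_quarters] at h2
  have hB : HasDerivAt (fun s => fB (a s) (k s)) (3 / 2 * (fK' (a t) (k t) * a t * (1 - a t) +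
      k t * fA' (a t) (k t) * (1 - 2 * a t))) t := by
    refine (((hk.const_mul (3 / 2)).fun_mul ha).fun_mul (ha.const_sub 1)).congr_deriv ?_
    ring
  have hG : HasDerivAt (fun s => fG (a s) (k s)) (fK' (a t) (k t) * (1 / 2 + a t - a t ^ 2) +
      k t * fA' (a t) (k t) * (1 - 2 * a t)) t := by
    refine (hk.fun_mul ((ha.const_add (1 / 2)).fun_sub (ha.fun_pow 2))).congr_deriv ?_
    push_cast
    ring
  refine ((((hB.const_mul 2).fun_sub ((hG.const_mul 6).fun_mul
    (h.flow.hasDerivAt_phi t x hx))).fun_add (hM.fun_mul h1)).fun_sub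
      (hM.fun_mul h2)).congr_deriv ?_
  rw [flowR, fS, fV1_right (h.a_lt t), fV1_left (h.a_lt t)]
  ring

theorem hasDerivAt_exp_U (t : ℝ) {x : ℝ} (hx : x ∈ Icc (0 : ℝ) 1) :
    HasDerivAt (fun s => Real.exp (U s x)) (Real.exp (U t x) * fV1 (a t) (k t) (φ t x)) t :=
  (h.flow.hasDerivAt_U t x hx).exp

/-- Change of variables for the derivative of a function composed with the flow. -/
theorem integral_comp_phi {F F' : ℝ → ℝ} (hF : ∀ y, HasDerivAt F (F' y) y) (hF' : Continuous F')
    (t x y : ℝ) :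
    ∫ s in x..y, Real.exp (U t s) * F' (φ t s) = F (φ t y) - F (φ t x) := by
  refine intervalIntegral.integral_eq_sub_of_hasDerivAt (f := fun s => F (φ t s))
    (fun s _ => ?_) (Continuous.intervalIntegrable ?_ _ _)
  · exact ((hF _).comp s (h.flow.hasDerivAt_space t s)).congr_deriv (mul_comm _ _)
  · exact (slice_continuous h.continuous_exp_U t).mul
      (hF'.comp (slice_continuous h.flow.continuous_phi t))

theorem continuous_fV1 (t : ℝ) : Continuous (fV1 (a t) (k t)) :=
  slice_continuous (continuous_uncurry_fV1 h.continuous_a h.continuous_k h.a_lt) t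

theorem continuous_fV (t : ℝ) : Continuous (fV (a t) (k t)) :=
  slice_continuous (continuous_uncurry_fV h.continuous_a h.continuous_k h.a_lt) t

theorem integral_flowQ' (t x : ℝ) :
    ∫ s in (0 : ℝ)..x, flowQ' a k U φ t s = fV1 (a t) (k t) (φ t x) := by
  rw [show (∫ s in (0 : ℝ)..x, flowQ' a k U φ t s) = _ from
    h.integral_comp_phi (hasDerivAt_fV1 (a t) (k t)) (continuous_fW _ _) t 0 x, h.flow.phi_left,
    fV1_zero (h.a_pos t) (h.a_lt t), sub_zero]

/-- Both sides vanish at time 0 and have time derivative `V' ∘ φ`. This identifies `exp U` with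
`eta` of the curve, and hence the flow with `phi`. -/
theorem integral_flowQ (t : ℝ) {x : ℝ} (hx : x ∈ Icc (0 : ℝ) 1) :
    ∫ s in (0 : ℝ)..x, flowQ a k U φ t s = U t x := by
  have hd : ∀ t, HasDerivAt (fun t => (∫ s in (0 : ℝ)..x, flowQ a k U φ t s) - U t x) 0 t := by
    intro t
    refine ((hasDerivAt_integral_param h.continuous_flowQ h.continuous_flowQ' hx.1
      (fun t y _ => h.hasDerivAt_flowQ t y) t).fun_sub (h.flow.hasDerivAt_U t x hx)).congr_deriv ?_
    rw [h.integral_flowQ', sub_self]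
  have := is_const_of_deriv_eq_zero (fun y => (hd y).differentiableAt) (fun y => (hd y).deriv) t 0
  simp only [flowQ, intervalIntegral.integral_same, h.flow.U_zero,
    intervalIntegral.integral_zero, sub_zero] at this
  exact sub_eq_zero.1 this

theorem eta_geoQ (t : ℝ) {x : ℝ} (hx : x ∈ Icc (0 : ℝ) 1) :
    eta (geoQ a k U φ t) x = Real.exp (U t x) := by
  rw [eta, geoQ, integral_congr_leb01 (coeFn_toL2 (slice_continuous h.continuous_flowQ t))
    (by simp) hx, h.integral_flowQ t hx]

theorem phi_geoQ (t : ℝ) {x : ℝ} (hx : x ∈ Icc (0 : ℝ) 1) : phi (geoQ a k U φ t) x = φ t x := by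
  rw [phi, integral_congr_Icc (fun s hs => h.eta_geoQ t hs) (by simp) hx]
  rw [intervalIntegral.integral_eq_sub_of_hasDerivAt (fun s _ => h.flow.hasDerivAt_space t s)
    ((slice_continuous h.continuous_exp_U t).intervalIntegrable _ _), h.flow.phi_left, sub_zero]

theorem coeFn_geoP (t : ℝ) : geoP a k φ t =ᵐ[leb01] flowP a k φ t :=
  coeFn_toL2 (slice_continuous h.continuous_flowP t)

theorem U_one (t : ℝ) : U t 1 = 0 := by
  have hd : ∀ t, HasDerivAt (fun t => U t 1) 0 t := fun t => by
    have := h.flow.hasDerivAt_U t 1 (by simp)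
    rwa [h.flow.phi_right, fV1_one (h.a_pos t) (h.a_lt t)] at this
  have := is_const_of_deriv_eq_zero (fun y => (hd y).differentiableAt) (fun y => (hd y).deriv) t 0
  rwa [h.flow.U_zero] at this

theorem geoQ_mem (t : ℝ) : geoQ a k U φ t ∈ Q := by
  have h1 : (1 : ℝ) ∈ Icc (0 : ℝ) 1 := by simp
  refine ⟨?_, (h.phi_geoQ t h1).trans (h.flow.phi_right t)⟩
  rw [geoQ, integral_congr_leb01 (coeFn_toL2 (slice_continuous h.continuous_flowQ t))
    (by simp) h1, h.integral_flowQ t h1, h.U_one]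

theorem innerEta_geoQ {t : ℝ} {f f' g g' : ℝ → ℝ} (hf : f =ᵐ[leb01] f')
    (hg : ∀ x ∈ Icc (0 : ℝ) 1, g x = g' x) :
    innerEta (geoQ a k U φ t) f g = ∫ x in (0 : ℝ)..1, Real.exp (U t x) * f' x * g' x := by
  refine integral_congr_leb01 ?_ (by simp) (by simp)
  filter_upwards [hf, ae_leb01 fun x hx => h.eta_geoQ t hx, ae_leb01 hg] with x h1 h2 h3
  rw [h1, h2, h3]

/-- In the Eulerian variable this is `∫ V'' y dy`, with primitive `V' y - V`, and `V`, `V'` vanish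
at both ends. -/
theorem integral_flowQ'_mul_phi (t : ℝ) :
    ∫ x in (0 : ℝ)..1, Real.exp (U t x) * flowP a k φ t x * φ t x = 0 := by
  have := h.integral_comp_phi (F := fun y => fV1 (a t) (k t) y * y - fV (a t) (k t) y)
    (F' := fun y => fW (a t) (k t) y * y)
    (fun y => (((hasDerivAt_fV1 _ _ y).fun_mul (hasDerivAt_id y)).fun_sub
      (hasDerivAt_fV _ _ y)).congr_deriv (by simp))
    ((continuous_fW _ _).mul continuous_id) t 0 1
  simp only [h.flow.phi_left, h.flow.phi_right, fV1_one (h.a_pos t) (h.a_lt t),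
    fV_one (h.a_pos t) (h.a_lt t), fV_zero (h.a_pos t) (h.a_lt t)] at this
  simp only [mul_assoc, flowP]
  simpa using this

theorem geoP_mem (t : ℝ) : geoP a k φ t ∈ cotangent (geoQ a k U φ t) := by
  refine ⟨?_, ?_⟩
  · rw [h.innerEta_geoQ (h.coeFn_geoP t) (g' := fun _ => 1) (fun _ _ => rfl)]
    simp only [mul_one]
    have := h.integral_flowQ' t 1
    rwa [h.flow.phi_right, fV1_one (h.a_pos t) (h.a_lt t)] at this
  · rw [h.innerEta_geoQ (h.coeFn_geoP t) (fun x hx => h.phi_geoQ t hx), h.integral_flowQ'_mul_phi]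

theorem hasDerivAt_geoQ (t : ℝ) :
    HasDerivAt (geoQ a k U φ) (toL2 (flowQ' a k U φ t)) t :=
  hasDerivAt_toL2 h.continuous_flowQ h.continuous_flowQ' (fun t x _ => h.hasDerivAt_flowQ t x) t

theorem hasDerivAt_geoP (t : ℝ) : HasDerivAt (geoP a k φ) (toL2 (flowR a k φ t)) t :=
  hasDerivAt_toL2 h.continuous_flowP h.continuous_flowR (fun t _ hx => h.hasDerivAt_flowP t hx) t

theorem velocity_ae (t : ℝ) : ∀ᵐ x ∂leb01,
    toL2 (flowQ' a k U φ t) x = eta (geoQ a k U φ t) x * geoP a k φ t x := by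
  filter_upwards [coeFn_toL2 (slice_continuous h.continuous_flowQ' t), h.coeFn_geoP t,
    ae_leb01 fun x hx => h.eta_geoQ t hx] with x h1 h2 h3
  rw [h1, h2, h3, flowQ']

/-- The time derivative of `flowQ'`. -/
theorem exists_hasDerivAt_flowQ' : ∃ g : ℝ → L2, Continuous g ∧
    ∀ t, HasDerivAt (fun t => toL2 (flowQ' a k U φ t)) (g t) t := by
  have hc : Continuous (Function.uncurry fun t x => Real.exp (U t x) * fV1 (a t) (k t) (φ t x) *
      flowP a k φ t x + Real.exp (U t x) * flowR a k φ t x) :=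
    ((h.continuous_exp_U.mul h.continuous_flowV1).mul h.continuous_flowP).add
      (h.continuous_exp_U.mul h.continuous_flowR)
  exact ⟨_, continuous_toL2 hc, hasDerivAt_toL2 h.continuous_flowQ' hc
    fun t x hx => (h.hasDerivAt_exp_U t hx).fun_mul (h.hasDerivAt_flowP t hx)⟩

end IsLandmarkFlow

end Geodesic

end DiffSpline

namespace DiffSpline

/-! ### The geodesic equation, the initial momentum, and the decay of the midpoint Jacobian. -/

section Geodesic

variable {a k : ℝ → ℝ} {U φ : ℝ → ℝ → ℝ}

/-- A constraint which holds for all times holds for the time derivatives. -/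
theorem integral_deriv_eq_zero {f f' : ℝ → ℝ → ℝ} (hf : Continuous (Function.uncurry f))
    (hf' : Continuous (Function.uncurry f'))
    (hd : ∀ t, ∀ y ∈ Icc (0 : ℝ) 1, HasDerivAt (f · y) (f' t y) t)
    (h0 : ∀ t, ∫ x in (0 : ℝ)..1, f t x = 0) (t : ℝ) : ∫ x in (0 : ℝ)..1, f' t x = 0 := by
  have h := hasDerivAt_integral_param hf hf' zero_le_one hd t
  simp only [h0] at h
  exact h.unique (hasDerivAt_const t 0)

/-- The coefficients of an affine function of `φ` are recovered from its moments. -/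
theorem gramComb_add (q : L2) (A B c d b x : ℝ) (hA : A = c + d / 2) (hB : B + b = c / 2 + d / 3) :
    gramComb q 0 b x + gramComb q A B x = c + d * phi q x := by
  have hb : b = c / 2 + d / 3 - B := by linarith
  rw [gramComb_eq, gramComb_eq, hb, hA]
  ring

namespace IsLandmarkFlow

variable (h : IsLandmarkFlow a k U φ)
include h

/-- Time derivative of the first cotangent constraint; the extra term `V' V''` is the derivative of
`V'² / 2` and integrates to zero. -/
theorem integral_flowR (t : ℝ) :
    ∫ x in (0 : ℝ)..1, Real.exp (U t x) * flowR a k φ t x = 0 := by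
  have h1 : Continuous (Function.uncurry fun t x =>
      Real.exp (U t x) * fV1 (a t) (k t) (φ t x) * flowP a k φ t x) :=
    (h.continuous_exp_U.mul h.continuous_flowV1).mul h.continuous_flowP
  have h2 : Continuous (Function.uncurry fun t x => Real.exp (U t x) * flowR a k φ t x) :=
    h.continuous_exp_U.mul h.continuous_flowR
  have h12 : Continuous (Function.uncurry fun t x =>
      Real.exp (U t x) * fV1 (a t) (k t) (φ t x) * flowP a k φ t x +
        Real.exp (U t x) * flowR a k φ t x) := h1.add h2
  have key := integral_deriv_eq_zero h.continuous_flowQ' h12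
    (fun t y hy => (h.hasDerivAt_exp_U t hy).fun_mul (h.hasDerivAt_flowP t hy))
    (fun t => by rw [h.integral_flowQ', h.flow.phi_right, fV1_one (h.a_pos t) (h.a_lt t)]) t
  have e := h.integral_comp_phi (F := fun y => fV1 (a t) (k t) y ^ 2 / 2)
    (F' := fun y => fV1 (a t) (k t) y * fW (a t) (k t) y)
    (fun y => (((hasDerivAt_fV1 _ _ y).fun_pow 2).div_const 2).congr_deriv (by push_cast; ring))
    ((h.continuous_fV1 t).mul (continuous_fW _ _)) t 0 1
  rw [h.flow.phi_left, h.flow.phi_right, fV1_one (h.a_pos t) (h.a_lt t),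
    fV1_zero (h.a_pos t) (h.a_lt t), sub_self] at e
  rw [intervalIntegral.integral_add ((slice_continuous h1 t).intervalIntegrable _ _)
    ((slice_continuous h2 t).intervalIntegrable _ _)] at key
  simp only [mul_assoc, flowP] at key e ⊢
  linarith

/-- Time derivative of the second cotangent constraint. The extra terms `V' V'' y + V'' V` equal an
exact derivative minus `(3/2) V'²`, which is the source of the factor 3/2 in `coeffB`. -/
theorem integral_flowR_mul_phi (t : ℝ) :
    ∫ x in (0 : ℝ)..1, Real.exp (U t x) * flowR a k φ t x * φ t x =
      (3 / 2) * ∫ x in (0 : ℝ)..1, Real.exp (U t x) * fV1 (a t) (k t) (φ t x) ^ 2 := by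
  have h1 : Continuous (Function.uncurry fun t x =>
      Real.exp (U t x) * fV1 (a t) (k t) (φ t x) * flowP a k φ t x +
        Real.exp (U t x) * flowR a k φ t x) :=
    ((h.continuous_exp_U.mul h.continuous_flowV1).mul h.continuous_flowP).add
      (h.continuous_exp_U.mul h.continuous_flowR)
  have h2 : Continuous (Function.uncurry fun t x =>
      (Real.exp (U t x) * fV1 (a t) (k t) (φ t x) * flowP a k φ t x +
        Real.exp (U t x) * flowR a k φ t x) * φ t x +
      Real.exp (U t x) * flowP a k φ t x * fV (a t) (k t) (φ t x)) :=
    (h1.mul h.flow.continuous_phi).add (h.continuous_flowQ'.mul h.continuous_flowV)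
  have key := integral_deriv_eq_zero
    (f := fun t x => Real.exp (U t x) * flowP a k φ t x * φ t x)
    (h.continuous_flowQ'.mul h.flow.continuous_phi) h2
    (fun t y hy => ((h.hasDerivAt_exp_U t hy).fun_mul (h.hasDerivAt_flowP t hy)).fun_mul
      (h.flow.hasDerivAt_phi t y hy)) h.integral_flowQ'_mul_phi t
  have e := h.integral_comp_phi
    (F := fun y => fV1 (a t) (k t) y ^ 2 / 2 * y + fV1 (a t) (k t) y * fV (a t) (k t) y)
    (F' := fun y => fV1 (a t) (k t) y * fW (a t) (k t) y * y +
      fW (a t) (k t) y * fV (a t) (k t) y + (3 / 2) * fV1 (a t) (k t) y ^ 2)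
    (fun y => (((((hasDerivAt_fV1 _ _ y).fun_pow 2).div_const 2).fun_mul
      (hasDerivAt_id y)).fun_add ((hasDerivAt_fV1 _ _ y).fun_mul
        (hasDerivAt_fV _ _ y))).congr_deriv (by push_cast; simp only [id]; ring))
    ((((h.continuous_fV1 t).mul (continuous_fW _ _)).mul continuous_id).add
      ((continuous_fW _ _).mul (h.continuous_fV t)) |>.add
        (((h.continuous_fV1 t).pow 2).const_mul (3 / 2))) t 0 1
  rw [h.flow.phi_left, h.flow.phi_right, fV1_one (h.a_pos t) (h.a_lt t),
    fV1_zero (h.a_pos t) (h.a_lt t)] at e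
  have c3 : Continuous fun x => Real.exp (U t x) * flowR a k φ t x * φ t x :=
    ((slice_continuous h.continuous_exp_U t).mul (slice_continuous h.continuous_flowR t)).mul
      (slice_continuous h.flow.continuous_phi t)
  have c4 : Continuous fun x => Real.exp (U t x) * fV1 (a t) (k t) (φ t x) ^ 2 :=
    (slice_continuous h.continuous_exp_U t).mul ((slice_continuous h.continuous_flowV1 t).pow 2)
  rw [← sub_eq_zero, ← intervalIntegral.integral_const_mul, ← intervalIntegral.integral_sub
    (c3.intervalIntegrable _ _) ((c4.const_mul _).intervalIntegrable _ _)]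
  -- The integrals of `key` and `e` both vanish, and the desired integrand is their difference.
  refine Eq.trans ?_ (sub_eq_zero.2 (key.trans (by rw [e]; ring :
    (0 : ℝ) = ∫ s in (0 : ℝ)..1, Real.exp (U t s) * _)))
  rw [← intervalIntegral.integral_sub ((slice_continuous h2 t).intervalIntegrable _ _)
    (Continuous.intervalIntegrable ?_ _ _)]
  · refine intervalIntegral.integral_congr fun x _ => ?_
    simp only [flowP]
    ring
  · exact (slice_continuous h.continuous_exp_U t).mul
      ((((((h.continuous_fV1 t).mul (continuous_fW _ _)).mul continuous_id).add
      ((continuous_fW _ _).mul (h.continuous_fV t))).add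
        (((h.continuous_fV1 t).pow 2).const_mul (3 / 2))).comp
          (slice_continuous h.flow.continuous_phi t))

theorem coeffB_geo (t : ℝ) : coeffB (geoP a k φ t) (geoQ a k U φ t) =
    (3 / 2) * ∫ x in (0 : ℝ)..1, Real.exp (U t x) * fV1 (a t) (k t) (φ t x) ^ 2 := by
  rw [coeffB]
  congr 1
  refine integral_congr_Icc (fun x hx => ?_) (by simp) (by simp)
  rw [h.eta_geoQ t hx, ← h.integral_flowQ' t x]
  congr 2
  refine integral_congr_leb01 ?_ (by simp) hx
  filter_upwards [h.coeFn_geoP t, ae_leb01 fun x hx => h.eta_geoQ t hx] with y h1 h2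
  rw [h1, h2, flowQ']

theorem opU_geo (t : ℝ) {x : ℝ} (hx : x ∈ Icc (0 : ℝ) 1) :
    opU (fun y => geoP a k φ t y ^ 2) (geoQ a k U φ t) x =
      (1 / 2) * ∫ y in φ t x..1, fW (a t) (k t) y ^ 2 := by
  have hc : Continuous fun y => fW (a t) (k t) y ^ 2 := (continuous_fW _ _).pow 2
  have e := h.integral_comp_phi (F := fun y => ∫ s in (0 : ℝ)..y, fW (a t) (k t) s ^ 2)
    (fun y => (hc.integral_hasStrictDerivAt 0 y).hasDerivAt) hc t x 1
  rw [intervalIntegral.integral_interval_sub_left (hc.intervalIntegrable _ _)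
    (hc.intervalIntegrable _ _), h.flow.phi_right] at e
  rw [opU, ← e]
  congr 1
  refine integral_congr_leb01 ?_ hx (by simp)
  filter_upwards [h.coeFn_geoP t, ae_leb01 fun x hx => h.eta_geoQ t hx] with y h1 h2
  rw [h1, h2, flowP]

/-- By `exists_affine_fS`, `ṗ + 𝒰(p²)` is an affine function `c + d φ`. The terms `π₁ + π₂` form the
affine function whose moments are those of `𝒰(p²)` plus `(0, b)`. The moments of `ṗ` are exactly
`(0, b)`, so the two affine functions coincide. -/
theorem accelFlat_geo (t : ℝ) : ∀ᵐ x ∂leb01,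
    accelFlat (geoP a k φ t) (geoQ a k U φ t) (toL2 (flowR a k φ t)) x = 0 := by
  obtain ⟨c, d, hcd⟩ := exists_affine_fS (k := k t) (h.a_lt t)
  set O : ℝ → ℝ := fun x => c + d * φ t x - flowR a k φ t x with hO
  have hOU : ∀ x ∈ Icc (0 : ℝ) 1,
      opU (fun y => geoP a k φ t y ^ 2) (geoQ a k U φ t) x = O x := fun x hx => by
    rw [h.opU_geo t hx]
    simp only [hO, flowR]
    linarith [hcd (φ t x)]
  have cE := slice_continuous h.continuous_exp_U t
  have cφ := slice_continuous h.flow.continuous_phi t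
  have cR := slice_continuous h.continuous_flowR t
  have m0 : ∫ x in (0 : ℝ)..1, Real.exp (U t x) * (c + d * φ t x) = c + d / 2 := by
    have := h.integral_comp_phi (F := fun y => c * y + d * (y ^ 2 / 2)) (F' := fun y => c + d * y)
      (fun y => (((hasDerivAt_id y).const_mul c).fun_add
        ((((hasDerivAt_id y).fun_pow 2).div_const 2).const_mul d)).congr_deriv
          (by push_cast; simp only [id]; ring)) (by fun_prop) t 0 1
    rw [this, h.flow.phi_left, h.flow.phi_right]; ring
  have m1 : ∫ x in (0 : ℝ)..1, Real.exp (U t x) * ((c + d * φ t x) * φ t x) = c / 2 + d / 3 := by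
    have := h.integral_comp_phi (F := fun y => c * (y ^ 2 / 2) + d * (y ^ 3 / 3))
      (F' := fun y => (c + d * y) * y)
      (fun y => (((((hasDerivAt_id y).fun_pow 2).div_const 2).const_mul c).fun_add
        ((((hasDerivAt_id y).fun_pow 3).div_const 3).const_mul d)).congr_deriv
          (by push_cast; simp only [id]; ring)) (by fun_prop) t 0 1
    rw [this, h.flow.phi_left, h.flow.phi_right]; ring
  have hA : innerEta (geoQ a k U φ t) (opU (fun y => geoP a k φ t y ^ 2) (geoQ a k U φ t))
      (fun _ => 1) = c + d / 2 := by
    have e : ∫ x in (0 : ℝ)..1, Real.exp (U t x) * O x * 1 =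
        (∫ x in (0 : ℝ)..1, Real.exp (U t x) * (c + d * φ t x)) -
          ∫ x in (0 : ℝ)..1, Real.exp (U t x) * flowR a k φ t x := by
      rw [← intervalIntegral.integral_sub
        ((cE.fun_mul ((cφ.const_mul d).const_add c)).intervalIntegrable _ _)
        ((cE.fun_mul cR).intervalIntegrable _ _)]
      refine intervalIntegral.integral_congr fun x _ => ?_
      simp only [hO]
      ring
    rw [h.innerEta_geoQ (ae_leb01 hOU) (fun _ _ => rfl), e, m0, h.integral_flowR, sub_zero]
  have hB : innerEta (geoQ a k U φ t) (opU (fun y => geoP a k φ t y ^ 2) (geoQ a k U φ t))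
      (phi (geoQ a k U φ t)) + coeffB (geoP a k φ t) (geoQ a k U φ t) = c / 2 + d / 3 := by
    have e : ∫ x in (0 : ℝ)..1, Real.exp (U t x) * O x * φ t x =
        (∫ x in (0 : ℝ)..1, Real.exp (U t x) * ((c + d * φ t x) * φ t x)) -
          ∫ x in (0 : ℝ)..1, Real.exp (U t x) * flowR a k φ t x * φ t x := by
      rw [← intervalIntegral.integral_sub
        ((cE.fun_mul (((cφ.const_mul d).const_add c).fun_mul cφ)).intervalIntegrable _ _)
        (((cE.fun_mul cR).fun_mul cφ).intervalIntegrable _ _)]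
      refine intervalIntegral.integral_congr fun x _ => ?_
      simp only [hO]
      ring
    rw [h.innerEta_geoQ (ae_leb01 hOU) (fun x hx => h.phi_geoQ t hx), e, m1, h.coeffB_geo,
      ← h.integral_flowR_mul_phi, sub_add_cancel]
  filter_upwards [coeFn_toL2 cR, ae_restrict_mem measurableSet_Icc] with x h1 hx
  have hg := gramComb_add (geoQ a k U φ t) _ _ c d _ x hA hB
  rw [accelFlat, pi1, pi2, projStar, h1, hOU x hx]
  rw [h.phi_geoQ t hx] at hg
  simp only [hO]
  linarith

theorem isGeodesic : IsGeodesic (geoP a k φ) (geoQ a k U φ) where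
  mem_Q t _ := h.geoQ_mem t
  mem_cotangent t _ := h.geoP_mem t
  velocity t _ := ⟨_, (h.hasDerivAt_geoQ t).hasDerivWithinAt, h.velocity_ae t⟩
  momentum t _ := ⟨_, (h.hasDerivAt_geoP t).hasDerivWithinAt, h.accelFlat_geo t⟩

theorem geoQ_zero : geoQ a k U φ 0 = 0 := by
  refine Lp.ext ?_
  filter_upwards [coeFn_toL2 (slice_continuous h.continuous_flowQ 0),
    Lp.coeFn_zero ℝ 2 leb01] with x h1 h2
  rw [geoQ, h1, h2, flowQ, intervalIntegral.integral_same]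
  rfl

theorem isLandmarkGeodesic :
    IsLandmarkGeodesic ![1, -1] ![1 / 4, 3 / 4] (geoP a k φ) (geoQ a k U φ) := by
  refine ⟨h.isGeodesic, h.geoQ_zero, h.geoQ_zero ▸ h.geoP_mem 0, fun g hg g0 g1 g0' g1' => ?_⟩
  have hd1 : ∀ x, HasDerivAt g (deriv g x) x := fun x =>
    (hg.differentiable (by norm_num) x).hasDerivAt
  have hg1 : ContDiff ℝ 1 (deriv g) := by
    have : ContDiff ℝ (1 + 1) g := by norm_num; exact hg
    exact (contDiff_succ_iff_deriv.1 this).2.2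
  have hd2 : ∀ x, HasDerivAt (deriv g) (deriv (deriv g) x) x := fun x =>
    (hg1.differentiable (by norm_num) x).hasDerivAt
  have hc2 : Continuous (deriv (deriv g)) := hg1.continuous_deriv (by norm_num)
  have hc1 : Continuous (deriv g) := hg1.continuous
  -- The kink at `b` is the Green function that reproduces `g b` when `g` and `g'` vanish at 1;
  -- affine functions are annihilated by the boundary conditions.
  have kink : ∀ b ∈ Icc (0 : ℝ) 1,
      ∫ x in (0 : ℝ)..1, (max x b - b) * deriv (deriv g) x = g b := fun b hb => by
    rw [intervalIntegral.integral_eq_sub_of_hasDerivAt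
      (f := fun x => (max x b - b) * deriv g (max x b) - g (max x b)) (fun x _ => ?_)
      (Continuous.intervalIntegrable (by fun_prop) _ _)]
    · simp only [max_eq_left hb.2, max_eq_right hb.1, g1, g1']
      ring
    · have := hasDerivAt_comp_max (f := fun x => (x - b) * deriv g x - g x)
        (f' := fun x => (x - b) * deriv (deriv g) x) (a := b) (fun x =>
          ((((hasDerivAt_id x).sub_const b).fun_mul (hd2 x)).fun_sub (hd1 x)).congr_deriv
            (by simp only [id]; ring)) (by simp) x
      refine this.congr_deriv ?_
      rcases le_total x b with hxb | hxb
      · simp only [max_eq_right hxb]; ring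
      · simp only [max_eq_left hxb]
  have aff : ∀ c d : ℝ, ∫ x in (0 : ℝ)..1, (c + d * x) * deriv (deriv g) x = 0 := fun c d => by
    rw [intervalIntegral.integral_eq_sub_of_hasDerivAt
      (f := fun x => (c + d * x) * deriv g x - d * g x) (fun x _ => ?_)
      (Continuous.intervalIntegrable (by fun_prop) _ _)]
    · simp only [g0, g0', g1, g1']
      ring
    · exact (((((hasDerivAt_id x).const_mul d).const_add c).fun_mul (hd2 x)).fun_sub
        ((hd1 x).const_mul d)).congr_deriv (by simp only [id]; ring)
  have e : ∫ x in (0 : ℝ)..1, geoP a k φ 0 x * deriv (deriv g) x =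
      ∫ x in (0 : ℝ)..1, ((2 * fB (1 / 4) (1 / 6) + (-6 * fG (1 / 4) (1 / 6)) * x) *
        deriv (deriv g) x + ((max x (1 / 4) - 1 / 4) * deriv (deriv g) x -
          (max x (3 / 4) - 3 / 4) * deriv (deriv g) x)) := by
    refine integral_congr_leb01 ?_ (by simp) (by simp)
    filter_upwards [h.coeFn_geoP 0] with x hx
    rw [hx, flowP, h.flow.phi_zero, h.a_zero, h.k_zero, fW,
      show fM (1 / 4) (1 / 6) = 1 by rw [fM]; norm_num, show (1 : ℝ) - 1 / 4 = 3 / 4 by norm_num]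
    ring
  rw [e, intervalIntegral.integral_add (Continuous.intervalIntegrable (by fun_prop) _ _)
    (Continuous.intervalIntegrable (by fun_prop) _ _), intervalIntegral.integral_sub
    (Continuous.intervalIntegrable (by fun_prop) _ _)
    (Continuous.intervalIntegrable (by fun_prop) _ _), aff, kink _ (by constructor <;> norm_num),
    kink _ (by constructor <;> norm_num)]
  simp
  ring

/-! ### The Jacobian at the midpoint -/

omit h in
/-- The rate at which the Jacobian at the midpoint decays. -/
noncomputable def decayRate (a k : ℝ → ℝ) (t : ℝ) : ℝ := 3 / 4 * (k t * a t ^ 2)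

theorem hasDerivAt_U_half (t : ℝ) : HasDerivAt (fun s => U s (1 / 2)) (-decayRate a k t) t := by
  have := h.flow.hasDerivAt_U t (1 / 2) (by constructor <;> norm_num)
  rw [h.phi_half, fV1_half (h.a_lt t)] at this
  exact this.congr_deriv (by rw [decayRate]; ring)

theorem decayRate_pos (t : ℝ) : 0 < decayRate a k t := by
  have := h.a_pos t
  have := h.k_pos t
  rw [decayRate]
  positivity

theorem strictAnti_U_half : StrictAnti fun s => U s (1 / 2) :=
  strictAnti_of_hasDerivAt_neg h.hasDerivAt_U_half fun t => neg_neg_of_pos (h.decayRate_pos t)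

/-- The decay rate is bounded below by a positive constant on nonnegative times. Such exponential
decay beats the factor `R ^ 2` in the choice of the time change. -/
theorem exists_U_half_le : ∃ c > 0, ∀ t, 0 ≤ t → U t (1 / 2) ≤ -(c * t) := by
  obtain ⟨c, hc, hb⟩ := h.bound
  refine ⟨3 / 4 * c, by positivity, fun t ht => ?_⟩
  have hd : ∀ s, HasDerivAt (fun s => U s (1 / 2) + 3 / 4 * c * s)
      (-decayRate a k s + 3 / 4 * c) s := fun s =>
    ((h.hasDerivAt_U_half s).fun_add ((hasDerivAt_id s).const_mul (3 / 4 * c))).congr_deriv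
      (by simp)
  have := antitoneOn_of_deriv_nonpos (convex_Ici (0 : ℝ))
    (f := fun s => U s (1 / 2) + 3 / 4 * c * s)
    (fun s _ => (hd s).continuousAt.continuousWithinAt)
    (fun s _ => (hd s).differentiableAt.differentiableWithinAt)
    (fun s hs => by
      rw [(hd s).deriv, decayRate]
      rw [interior_Ici] at hs
      linarith [hb s (le_of_lt hs)]) (self_mem_Ici) ht ht
  simp only [h.flow.U_zero] at this
  linarith

theorem strictAntiOn_eta_half : StrictAntiOn (fun t => eta (geoQ a k U φ t) (1 / 2)) (Ici 0) := by
  intro s _ t _ hst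
  simp only
  rw [h.eta_geoQ _ (by constructor <;> norm_num), h.eta_geoQ _ (by constructor <;> norm_num)]
  exact Real.exp_lt_exp.2 (h.strictAnti_U_half hst)

theorem tendsto_eta_half : Tendsto (fun t => eta (geoQ a k U φ t) (1 / 2)) atTop (𝓝 0) := by
  obtain ⟨c, hc, hU⟩ := h.exists_U_half_le
  have e : (fun t => eta (geoQ a k U φ t) (1 / 2)) = fun t => Real.exp (U t (1 / 2)) :=
    funext fun t => h.eta_geoQ _ (by constructor <;> norm_num)
  rw [e]
  refine Real.tendsto_exp_atBot.comp (tendsto_atBot_mono' _ ?_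
    (tendsto_neg_atTop_atBot.comp (tendsto_id.const_mul_atTop hc)))
  filter_upwards [eventually_ge_atTop 0] with t ht using hU t ht

end IsLandmarkFlow

end Geodesic

end DiffSpline

namespace DiffSpline

/-! ### Reparametrized geodesics -/

section Scaling

variable {q p r e : L2} {c : ℝ}

theorem innerEta_congr {f f' : ℝ → ℝ} (hf : f =ᵐ[leb01] f') (g : ℝ → ℝ) :
    innerEta q f g = innerEta q f' g := by
  refine integral_congr_leb01 ?_ (by simp) (by simp)
  filter_upwards [hf] with x hx
  rw [hx]

theorem innerEta_const_mul (c : ℝ) (f g : ℝ → ℝ) :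
    innerEta q (fun x => c * f x) g = c * innerEta q f g := by
  rw [innerEta, innerEta, ← intervalIntegral.integral_const_mul]
  exact intervalIntegral.integral_congr fun x _ => by ring

theorem coeFn_smul_L2 (c : ℝ) (p : L2) : (c • p : L2) =ᵐ[leb01] fun x => c * p x := by
  filter_upwards [Lp.coeFn_smul c p] with x hx
  rw [hx, Pi.smul_apply, smul_eq_mul]

theorem smul_mem_cotangent (hp : p ∈ cotangent q) (c : ℝ) : c • p ∈ cotangent q := by
  refine ⟨?_, ?_⟩
  · rw [innerEta_congr (coeFn_smul_L2 c p), innerEta_const_mul, hp.1, mul_zero]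
  · rw [innerEta_congr (coeFn_smul_L2 c p), innerEta_const_mul, hp.2, mul_zero]

theorem pi2_eq (q : L2) (f : ℝ → ℝ) (x : ℝ) : pi2 q f x =
    gramComb q (innerEta q (opU f q) fun _ => 1) (innerEta q (opU f q) (phi q)) x := by
  rw [pi2, projStar, sub_sub_cancel]

theorem opU_smul_sq (c : ℝ) (p q : L2) {x : ℝ} (hx : x ∈ Icc (0 : ℝ) 1) :
    opU (fun y => (c • p : L2) y ^ 2) q x = c ^ 2 * opU (fun y => p y ^ 2) q x := by
  rw [opU, opU, mul_left_comm, ← intervalIntegral.integral_const_mul (c ^ 2)]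
  congr 1
  refine integral_congr_leb01 ?_ hx (by simp)
  filter_upwards [coeFn_smul_L2 c p] with y hy
  rw [hy]; ring

theorem coeffB_smul (c : ℝ) (p q : L2) : coeffB (c • p) q = c ^ 2 * coeffB p q := by
  rw [coeffB, coeffB, mul_left_comm, ← intervalIntegral.integral_const_mul (c ^ 2)]
  congr 1
  refine integral_congr_Icc (fun x hx => ?_) (by simp) (by simp)
  have : ∫ y in (0 : ℝ)..x, eta q y * (c • p : L2) y = c * ∫ y in (0 : ℝ)..x, eta q y * p y := by
    rw [← intervalIntegral.integral_const_mul]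
    refine integral_congr_leb01 ?_ (by simp) hx
    filter_upwards [coeFn_smul_L2 c p] with y hy
    rw [hy]; ring
  rw [this]; ring

/-- The acceleration covector is quadratic in the momentum, up to the term `ṗ`. -/
theorem accelFlat_smul (c : ℝ) (p q r e : L2) : ∀ᵐ x ∂leb01,
    accelFlat (c • p) q (e + c • c • r) x = e x + c ^ 2 * accelFlat p q r x := by
  have hU : opU (fun y => (c • p : L2) y ^ 2) q =ᵐ[leb01]
      fun x => c ^ 2 * opU (fun y => p y ^ 2) q x := ae_leb01 fun x hx => opU_smul_sq c p q hx
  filter_upwards [Lp.coeFn_add e (c • c • r), coeFn_smul_L2 c (c • r), coeFn_smul_L2 c r, hU]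
    with x h1 h2 h3 h4
  rw [accelFlat, accelFlat, h1, Pi.add_apply, h2, h3, h4, pi1, pi1, pi2_eq, pi2_eq,
    innerEta_congr hU, innerEta_congr hU, innerEta_const_mul, innerEta_const_mul, coeffB_smul]
  simp only [gramComb_eq]
  ring

end Scaling

/-! ### Exponential time changes of the geodesic. -/

section Reparam

/-- The time change `A (exp (l t) - 1)`. -/
noncomputable def expTime (A l t : ℝ) : ℝ := A * (Real.exp (l * t) - 1)

/-- The derivative of `expTime`. -/
noncomputable def expTime' (A l t : ℝ) : ℝ := l * (expTime A l t + A)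

theorem hasDerivAt_expTime (A l t : ℝ) : HasDerivAt (expTime A l) (expTime' A l t) t := by
  refine (((((hasDerivAt_id t).const_mul l).exp).sub_const 1).const_mul A).congr_deriv ?_
  simp only [expTime', expTime, id]
  ring

theorem deriv_expTime (A l : ℝ) : deriv (expTime A l) = expTime' A l :=
  funext fun t => (hasDerivAt_expTime A l t).deriv

theorem hasDerivAt_expTime' (A l t : ℝ) : HasDerivAt (expTime' A l) (l * expTime' A l t) t :=
  ((hasDerivAt_expTime A l t).add_const A).const_mul l

theorem continuous_expTime (A l : ℝ) : Continuous (expTime A l) := by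
  unfold expTime; fun_prop

theorem continuous_expTime' (A l : ℝ) : Continuous (expTime' A l) :=
  continuous_const.mul ((continuous_expTime A l).add continuous_const)

theorem expTime'_pos {A l : ℝ} (hA : 0 < A) (hl : 0 < l) (t : ℝ) : 0 < expTime' A l t := by
  rw [expTime', expTime]
  have := Real.exp_pos (l * t)
  have : 0 < A * Real.exp (l * t) := by positivity
  apply mul_pos hl
  linarith

theorem expTime_zero (A l : ℝ) : expTime A l 0 = 0 := by simp [expTime]

theorem expTime_nonneg {A l t : ℝ} (hA : 0 < A) (hl : 0 < l) (ht : 0 ≤ t) : 0 ≤ expTime A l t := by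
  have : 1 ≤ Real.exp (l * t) := Real.one_le_exp (by positivity)
  exact mul_nonneg hA.le (by linarith)

theorem isTimeReparam_expTime {A l : ℝ} (hA : 0 < A) (hl : 0 < l) :
    IsTimeReparam (expTime A l) where
  smooth := by
    unfold expTime
    exact contDiff_const.mul ((Real.contDiff_exp.comp (contDiff_const.mul contDiff_id)).sub
      contDiff_const)
  start := expTime_zero A l
  deriv_pos t _ := by rw [deriv_expTime]; exact expTime'_pos hA hl t

variable {a k : ℝ → ℝ} {U φ : ℝ → ℝ → ℝ}

namespace IsLandmarkFlow

variable (h : IsLandmarkFlow a k U φ)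
include h

theorem hasDerivAt_reparamQ (A l t : ℝ) :
    HasDerivAt (fun t => geoQ a k U φ (expTime A l t))
      (expTime' A l t • toL2 (flowQ' a k U φ (expTime A l t))) t :=
  (h.hasDerivAt_geoQ _).scomp t (hasDerivAt_expTime A l t)

theorem hasDerivAt_reparamP (A l t : ℝ) :
    HasDerivAt (fun t => expTime' A l t • geoP a k φ (expTime A l t))
      ((l * expTime' A l t) • geoP a k φ (expTime A l t) +
        expTime' A l t • expTime' A l t • toL2 (flowR a k φ (expTime A l t))) t := by
  rw [add_comm]
  exact (hasDerivAt_expTime' A l t).smul ((h.hasDerivAt_geoP _).scomp t (hasDerivAt_expTime A l t))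

theorem isCurve_reparam (A l : ℝ) : IsCurve (expTime' A l 0 • geoP a k φ (expTime A l 0))
    (geoQ a k U φ (expTime A l 0)) (fun t => expTime' A l t • geoP a k φ (expTime A l t))
    (fun t => geoQ a k U φ (expTime A l t)) where
  memH2 := by
    obtain ⟨g, hg, hdg⟩ := h.exists_hasDerivAt_flowQ'
    set v' : ℝ → L2 := fun t => expTime' A l t • (expTime' A l t • g (expTime A l t)) +
      (l * expTime' A l t) • toL2 (flowQ' a k U φ (expTime A l t)) with hv'
    have hd : ∀ t, HasDerivAt (fun t => expTime' A l t • toL2 (flowQ' a k U φ (expTime A l t)))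
        (v' t) t := fun t =>
      (hasDerivAt_expTime' A l t).smul ((hdg _).scomp t (hasDerivAt_expTime A l t))
    have hQc : Continuous fun t => toL2 (flowQ' a k U φ t) :=
      continuous_iff_continuousAt.2 fun t => (hdg t).continuousAt
    have c1 := continuous_expTime A l
    have c2 := continuous_expTime' A l
    have hvc : Continuous v' := by
      refine (c2.smul (c2.smul (hg.comp c1))).add ((continuous_const.mul c2).smul (hQc.comp c1))
    refine ⟨_, ⟨v', ?_, fun t _ => ?_⟩, fun t _ => (h.hasDerivAt_reparamQ A l t).hasDerivWithinAt⟩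
    · obtain ⟨M, hM⟩ := isCompact_Icc.exists_bound_of_continuousOn (s := Icc (0 : ℝ) 1)
        hvc.continuousOn
      exact MemLp.of_bound hvc.aestronglyMeasurable M (ae_leb01 hM)
    · rw [intervalIntegral.integral_eq_sub_of_hasDerivAt (fun s _ => hd s)
        (hvc.intervalIntegrable _ _)]
      abel
  mem_Q t _ := h.geoQ_mem _
  mem_cotangent t _ := smul_mem_cotangent (h.geoP_mem _) _
  velocity t _ := by
    refine ⟨_, (h.hasDerivAt_reparamQ A l t).hasDerivWithinAt, ?_⟩
    filter_upwards [h.velocity_ae (expTime A l t), coeFn_smul_L2 (expTime' A l t)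
      (toL2 (flowQ' a k U φ (expTime A l t))), coeFn_smul_L2 (expTime' A l t)
      (geoP a k φ (expTime A l t))] with x h1 h2 h3
    rw [h2, h3, h1]; ring
  start_p := rfl
  start_q := rfl

/-- All terms of order `α'²` cancel by the geodesic equation; what remains is `α'' p₀(α)` with `α''
= l α'`. -/
theorem accelFlat_reparam (A l t : ℝ) : ∀ᵐ x ∂leb01,
    accelFlat (expTime' A l t • geoP a k φ (expTime A l t)) (geoQ a k U φ (expTime A l t))
      (deriv (fun t => expTime' A l t • geoP a k φ (expTime A l t)) t) x =
    l * expTime' A l t * flowP a k φ (expTime A l t) x := by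
  rw [(h.hasDerivAt_reparamP A l t).deriv]
  filter_upwards [accelFlat_smul (expTime' A l t) (geoP a k φ (expTime A l t))
    (geoQ a k U φ (expTime A l t)) (toL2 (flowR a k φ (expTime A l t)))
    ((l * expTime' A l t) • geoP a k φ (expTime A l t)), h.accelFlat_geo (expTime A l t),
    coeFn_smul_L2 (l * expTime' A l t) (geoP a k φ (expTime A l t)),
    h.coeFn_geoP (expTime A l t)] with x h1 h2 h3 h4
  rw [h1, h2, h3, h4, mul_zero, add_zero]

end IsLandmarkFlow

end Reparam

end DiffSpline

namespace DiffSpline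

/-! ### Defect measures carried by the line `x = 1 / 2` -/

section LineMeasure

/-- The measure `ρ(t) dt` on `[0,1]`. -/
noncomputable def densMeas (ρ : ℝ → ℝ) : Measure ℝ :=
  leb01.withDensity fun t => ENNReal.ofReal (ρ t)

/-- The measure `ρ(t) dt ⊗ δ_{1/2}` on `[0,1]²`. -/
noncomputable def lineMeas (ρ : ℝ → ℝ) : Measure (ℝ × ℝ) :=
  (densMeas ρ).map fun t => (t, 1 / 2)

theorem measurableEmbedding_line : MeasurableEmbedding fun t : ℝ => (t, (1 / 2 : ℝ)) :=
  measurableEmbedding_prod_mk_right _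

variable {ρ ρ' : ℝ → ℝ}

theorem integrable_leb01 {f : ℝ → ℝ} (hf : Continuous f) : Integrable f leb01 :=
  hf.integrableOn_Icc

theorem isFiniteMeasure_densMeas (hρ : Continuous ρ) : IsFiniteMeasure (densMeas ρ) :=
  isFiniteMeasure_withDensity_ofReal (integrable_leb01 hρ).2

theorem isFiniteMeasure_lineMeas (hρ : Continuous ρ) : IsFiniteMeasure (lineMeas ρ) :=
  have := isFiniteMeasure_densMeas hρ
  Measure.isFiniteMeasure_map _ _

theorem integral_leb01 (f : ℝ → ℝ) : ∫ t, f t ∂leb01 = ∫ t in (0 : ℝ)..1, f t := by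
  rw [intervalIntegral.integral_of_le zero_le_one, integral_Icc_eq_integral_Ioc]

theorem integral_lineMeas (hρ : Continuous ρ) (h0 : ∀ t ∈ Icc (0 : ℝ) 1, 0 ≤ ρ t)
    (f : ℝ × ℝ → ℝ) :
    ∫ z, f z ∂lineMeas ρ = ∫ t in (0 : ℝ)..1, ρ t * f (t, 1 / 2) := by
  rw [lineMeas, measurableEmbedding_line.integral_map, densMeas,
    integral_withDensity_eq_integral_toReal_smul hρ.measurable.ennreal_ofReal (by simp),
    integral_leb01]
  refine integral_congr_Icc (fun t ht => ?_) (by simp) (by simp)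
  rw [ENNReal.toReal_ofReal (h0 t ht), smul_eq_mul]

theorem lintegral_lineMeas (g : ℝ × ℝ → ℝ≥0∞) :
    ∫⁻ z, g z ∂lineMeas ρ = ∫⁻ t, g (t, 1 / 2) ∂densMeas ρ :=
  measurableEmbedding_line.lintegral_map g

theorem ae_densMeas {p : ℝ → Prop} (h : ∀ᵐ t ∂leb01, p t) : ∀ᵐ t ∂densMeas ρ, p t :=
  (withDensity_absolutelyContinuous _ _).ae_le h

theorem lineMeas_compl_D : lineMeas ρ Dᶜ = 0 := by
  have : ∀ᵐ z ∂lineMeas ρ, z ∈ D :=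
    measurableEmbedding_line.ae_map_iff.2 (ae_densMeas (ae_leb01 fun t ht =>
      ⟨ht, by constructor <;> norm_num⟩))
  exact this

theorem toJordanDecomposition_toSignedMeasure {α : Type*} [MeasurableSpace α] (N : Measure α)
    [IsFiniteMeasure N] : N.toSignedMeasure.toJordanDecomposition =
      ⟨N, 0, Measure.MutuallySingular.zero_right⟩ := by
  rw [← JordanDecomposition.toJordanDecomposition_toSignedMeasure
    ⟨N, 0, Measure.MutuallySingular.zero_right⟩]
  simp [JordanDecomposition.toSignedMeasure]

theorem totalVariation_toSignedMeasure {α : Type*} [MeasurableSpace α] (N : Measure α)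
    [IsFiniteMeasure N] : N.toSignedMeasure.totalVariation = N := by
  rw [SignedMeasure.totalVariation, toJordanDecomposition_toSignedMeasure, add_zero]

theorem rnDeriv_toSignedMeasure {α : Type*} [MeasurableSpace α] (N ν : Measure α)
    [IsFiniteMeasure N] [SigmaFinite ν] :
    N.toSignedMeasure.rnDeriv ν =ᵐ[ν] fun z => (N.rnDeriv ν z).toReal := by
  filter_upwards [Measure.rnDeriv_zero ν] with z hz
  rw [SignedMeasure.rnDeriv, toJordanDecomposition_toSignedMeasure]
  simp [hz]

/-- Integration by parts along the line: the boundary terms vanish because `ρ 0 = 0` and test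
functions vanish at time 1. -/
theorem isTimeDeriv_lineMeas (hd : ∀ t, HasDerivAt ρ (ρ' t) t) (hρ' : Continuous ρ')
    (h0 : ∀ t ∈ Icc (0 : ℝ) 1, 0 ≤ ρ t) (h0' : ∀ t ∈ Icc (0 : ℝ) 1, 0 ≤ ρ' t) (hz : ρ 0 = 0)
    [IsFiniteMeasure (lineMeas ρ')] :
    IsTimeDeriv (lineMeas ρ) (lineMeas ρ').toSignedMeasure := by
  have hρ : Continuous ρ := continuous_iff_continuousAt.2 fun t => (hd t).continuousAt
  refine ⟨by rw [totalVariation_toSignedMeasure, lineMeas_compl_D], fun f ft hf h1 => ?_⟩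
  have hm : ∀ t ∈ Icc (0 : ℝ) 1, (t, (1 / 2 : ℝ)) ∈ D := fun t ht =>
    ⟨ht, by constructor <;> norm_num⟩
  have cf : ContinuousOn (fun t => f (t, 1 / 2)) (Icc 0 1) :=
    hf.cont.comp (by fun_prop) hm
  have cft : ContinuousOn (fun t => ft (t, 1 / 2)) (Icc 0 1) :=
    hf.cont_deriv.comp (by fun_prop) hm
  have i1 : IntervalIntegrable (fun t => ρ t * ft (t, 1 / 2)) volume 0 1 :=
    (ContinuousOn.mul hρ.continuousOn cft).intervalIntegrable_of_Icc zero_le_one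
  have i2 : IntervalIntegrable (fun t => ρ' t * f (t, 1 / 2)) volume 0 1 :=
    (ContinuousOn.mul hρ'.continuousOn cf).intervalIntegrable_of_Icc zero_le_one
  rw [VectorMeasure.integral_toSignedMeasure, integral_lineMeas hρ h0, integral_lineMeas hρ' h0',
    ← intervalIntegral.integral_add i1 i2,
    intervalIntegral.integral_eq_sub_of_hasDerivAt_of_le (f := fun t => ρ t * f (t, 1 / 2))
      zero_le_one (ContinuousOn.mul hρ.continuousOn cf) (fun t ht => ?_) (i1.add i2), hz,
    h1 (1 / 2) (by constructor <;> norm_num)]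
  · ring
  · have := (hf.hasDeriv t (Ioo_subset_Icc_self ht) (1 / 2)
      (by constructor <;> norm_num)).hasDerivAt (Icc_mem_nhds ht.1 ht.2)
    exact ((hd t).fun_mul this).congr_deriv (by ring)

theorem lineMeas_add (hρ : Continuous ρ) (h0 : ∀ t ∈ Icc (0 : ℝ) 1, 0 ≤ ρ t)
    (h0' : ∀ t ∈ Icc (0 : ℝ) 1, 0 ≤ ρ' t) :
    lineMeas ρ + lineMeas ρ' = lineMeas fun t => ρ t + ρ' t := by
  rw [lineMeas, lineMeas, lineMeas, ← Measure.map_add _ _ measurableEmbedding_line.measurable,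
    densMeas, densMeas, densMeas, ← withDensity_add_left hρ.measurable.ennreal_ofReal]
  congr 1
  refine withDensity_congr_ae (ae_leb01 fun t ht => ?_)
  exact (ENNReal.ofReal_add (h0 t ht) (h0' t ht)).symm

/-- The density of one line measure with respect to another. -/
theorem rnDeriv_lineMeas {σ : ℝ → ℝ} (hρ : Continuous ρ) (hσ : Continuous σ)
    (hpos : ∀ t ∈ Ioc (0 : ℝ) 1, 0 < σ t) :
    ∀ᵐ t ∂densMeas σ, (lineMeas ρ).rnDeriv (lineMeas σ) (t, 1 / 2) =
      ENNReal.ofReal (ρ t / σ t) := by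
  have := isFiniteMeasure_densMeas hσ
  have := isFiniteMeasure_densMeas hρ
  have hm : Measurable fun t => ENNReal.ofReal (ρ t / σ t) :=
    (hρ.measurable.div hσ.measurable).ennreal_ofReal
  have e : densMeas ρ = (densMeas σ).withDensity fun t => ENNReal.ofReal (ρ t / σ t) := by
    rw [densMeas, densMeas, ← withDensity_mul _ hσ.measurable.ennreal_ofReal hm]
    refine withDensity_congr_ae ?_
    have h0 : ∀ᵐ t ∂leb01, t ≠ 0 := Measure.ae_ne _ _
    filter_upwards [h0, ae_restrict_mem measurableSet_Icc] with t h1 h2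
    have := hpos t ⟨lt_of_le_of_ne h2.1 h1.symm, h2.2⟩
    rw [Pi.mul_apply, ← ENNReal.ofReal_mul this.le, mul_div_cancel₀ _ this.ne']
  have h1 := measurableEmbedding_line.rnDeriv_map (densMeas ρ) (densMeas σ)
  have h2 := Measure.rnDeriv_withDensity (densMeas σ) hm
  rw [← e] at h2
  filter_upwards [h1, h2] with t ht1 ht2
  rw [← ht2, ← ht1]
  rfl

/-- Both measures live on the same line, with densities `ρ / (ρ + ρ')` and `ρ' / (ρ + ρ')` relative
to their sum, so homogeneity gives the integrand `ρ'² / (4 ρ)`. The zero of `ρ` at time 0 is a null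
set. -/
theorem fisherRao_lineMeas_le (hρ : Continuous ρ) (hρ' : Continuous ρ')
    (hpos : ∀ t ∈ Ioc (0 : ℝ) 1, 0 < ρ t) (h0 : ∀ t ∈ Icc (0 : ℝ) 1, 0 ≤ ρ t)
    (h0' : ∀ t ∈ Icc (0 : ℝ) 1, 0 ≤ ρ' t)
    [IsFiniteMeasure (lineMeas ρ')] {f : ℝ × ℝ → ℝ} {w : ℝ → ℝ} (hw : Continuous w)
    (hf : ∀ t ∈ Icc (0 : ℝ) 1, f (t, 1 / 2) = w t) :
    fisherRao f (lineMeas ρ) (lineMeas ρ').toSignedMeasure ≤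
      ∫⁻ t in Icc (0 : ℝ) 1, ENNReal.ofReal (ρ' t ^ 2 / (4 * ρ t) * w t) := by
  have hσ : Continuous fun t => ρ t + ρ' t := hρ.add hρ'
  have hσpos : ∀ t ∈ Ioc (0 : ℝ) 1, 0 < ρ t + ρ' t := fun t ht =>
    add_pos_of_pos_of_nonneg (hpos t ht) (h0' t (Ioc_subset_Icc_self ht))
  have := isFiniteMeasure_lineMeas hσ
  rw [fisherRao, totalVariation_toSignedMeasure, lineMeas_add hρ h0 h0']
  have hdt : ∀ᵐ t ∂densMeas fun t => ρ t + ρ' t, t ∈ Ioc (0 : ℝ) 1 := by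
    refine ae_densMeas ?_
    have h0 : ∀ᵐ t ∂leb01, t ≠ 0 := Measure.ae_ne _ _
    filter_upwards [h0, ae_restrict_mem measurableSet_Icc] with t h1 h2
    exact ⟨lt_of_le_of_ne h2.1 h1.symm, h2.2⟩
  have hs := measurableEmbedding_line.ae_map_iff.1
    (rnDeriv_toSignedMeasure (lineMeas ρ') (lineMeas fun t => ρ t + ρ' t))
  rw [lintegral_lineMeas]
  have hae : ∀ᵐ t ∂densMeas fun t => ρ t + ρ' t,
      frIntegrand ((lineMeas ρ).rnDeriv (lineMeas fun t => ρ t + ρ' t) (t, 1 / 2)).toReal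
        ((lineMeas ρ').toSignedMeasure.rnDeriv (lineMeas fun t => ρ t + ρ' t) (t, 1 / 2)) *
        ENNReal.ofReal (f (t, 1 / 2)) =
      ENNReal.ofReal (1 / 4 * ((ρ' t / (ρ t + ρ' t)) ^ 2 / (ρ t / (ρ t + ρ' t)))) *
        ENNReal.ofReal (w t) := by
    filter_upwards [rnDeriv_lineMeas hρ hσ hσpos, rnDeriv_lineMeas hρ' hσ hσpos, hs, hdt]
      with t h1 h2 h3 ht
    have hp := hpos t ht
    have hσp := hσpos t ht
    have ht' := Ioc_subset_Icc_self ht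
    rw [h3, h1, h2, hf t ht', ENNReal.toReal_ofReal (div_nonneg hp.le hσp.le),
      ENNReal.toReal_ofReal (div_nonneg (h0' t ht') hσp.le), frIntegrand,
      if_pos (div_pos hp hσp)]
  rw [lintegral_congr_ae hae, densMeas, lintegral_withDensity_eq_lintegral_mul _
    hσ.measurable.ennreal_ofReal]
  · refine lintegral_mono_ae ?_
    have h0 : ∀ᵐ t ∂leb01, t ≠ 0 := Measure.ae_ne _ _
    filter_upwards [h0, ae_restrict_mem measurableSet_Icc] with t h1 h2
    have ht : t ∈ Ioc (0 : ℝ) 1 := ⟨lt_of_le_of_ne h2.1 h1.symm, h2.2⟩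
    have hp := hpos t ht
    have hσp := hσpos t ht
    rw [Pi.mul_apply, ← mul_assoc, ← ENNReal.ofReal_mul hσp.le,
      ← ENNReal.ofReal_mul (by positivity)]
    refine ENNReal.ofReal_le_ofReal (le_of_eq ?_)
    field_simp
  · have m1 := hρ.measurable
    have m2 := hρ'.measurable
    have m3 := hw.measurable
    fun_prop

/-- The slices of a line measure. -/
theorem slice_lineMeas (hρ : Continuous ρ) {Δ : FiniteMeasure (ℝ × ℝ)}
    (hΔ : (Δ : Measure (ℝ × ℝ)) = lineMeas ρ) :
    ∀ᵐ t ∂leb01, slice Δ t = ENNReal.ofReal (ρ t) • Measure.dirac (1 / 2) := by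
  have := isFiniteMeasure_densMeas hρ
  have hfst : (Δ : Measure (ℝ × ℝ)).fst = densMeas ρ := by
    rw [hΔ, lineMeas, Measure.fst_map_prodMk measurable_const]
    exact Measure.map_id
  have hm : Measurable fun t => ENNReal.ofReal (ρ t) := hρ.measurable.ennreal_ofReal
  have h1 : ∀ᵐ t ∂leb01, (Δ : Measure (ℝ × ℝ)).fst.rnDeriv volume t = ENNReal.ofReal (ρ t) := by
    rw [hfst, densMeas, ← withDensity_indicator measurableSet_Icc]
    filter_upwards [ae_restrict_of_ae (Measure.rnDeriv_withDensity volume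
      (hm.indicator measurableSet_Icc)), ae_restrict_mem measurableSet_Icc] with t ht hm
    rw [ht, indicator_of_mem hm]
  have hk : (Δ : Measure (ℝ × ℝ)) = (Δ : Measure (ℝ × ℝ)).fst.compProd
      (ProbabilityTheory.Kernel.const ℝ (Measure.dirac (1 / 2 : ℝ))) := by
    rw [hfst, Measure.compProd_const, Measure.prod_dirac, hΔ, lineMeas]
  have h2 := ProbabilityTheory.eq_condKernel_of_measure_eq_compProd _ hk
  rw [hfst, densMeas, ae_withDensity_iff hm] at h2
  filter_upwards [h1, h2] with t ht1 ht2
  rw [slice, ht1]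
  -- Where the time marginal has zero density the conditional measure is undetermined, but the slice
  -- carries the factor zero.
  by_cases h0 : ENNReal.ofReal (ρ t) = 0
  · rw [h0, zero_smul, zero_smul]
  · rw [← ht2 h0, ProbabilityTheory.Kernel.const_apply]

theorem opUMeas_smul_dirac (q : L2) {c : ℝ} (hc : 0 ≤ c) {x : ℝ} :
    opUMeas (ENNReal.ofReal c • Measure.dirac (1 / 2)) q x =
      (1 / 2) * c * eta q (1 / 2) * (Iic (1 / 2 : ℝ)).indicator 1 x := by
  classical
  rw [opUMeas, Measure.restrict_smul, integral_smul_measure, setIntegral_dirac,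
    ENNReal.toReal_ofReal hc, smul_eq_mul]
  by_cases hx : x ≤ 1 / 2
  · rw [if_pos ⟨hx, by norm_num⟩, indicator_of_mem (show x ∈ Iic (1 / 2 : ℝ) from hx)]
    simp only [Pi.one_apply]
    ring
  · rw [if_neg (fun h => hx h.1), indicator_of_notMem (show x ∉ Iic (1 / 2 : ℝ) from hx)]
    ring

end LineMeasure

end DiffSpline

namespace DiffSpline

/-! ### The relaxed energy near `Δ = 0` -/

section Energy

theorem mul_indicator_half (F : ℝ → ℝ) (x : ℝ) :
    F x * (Iic (1 / 2 : ℝ)).indicator 1 x = (Iic (1 / 2 : ℝ)).indicator F x := by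
  by_cases hx : x ∈ Iic (1 / 2 : ℝ)
  · rw [indicator_of_mem hx, indicator_of_mem hx, Pi.one_apply, mul_one]
  · rw [indicator_of_notMem hx, indicator_of_notMem hx, mul_zero]

theorem integral_mul_indicator_half (F : ℝ → ℝ) :
    ∫ x in (0 : ℝ)..1, F x * (Iic (1 / 2 : ℝ)).indicator 1 x = ∫ x in (0 : ℝ)..1 / 2, F x := by
  simp only [mul_indicator_half]
  rw [intervalIntegral.integral_of_le zero_le_one, intervalIntegral.integral_of_le (by norm_num),
    setIntegral_indicator measurableSet_Iic, Ioc_inter_Iic, min_eq_right (by norm_num)]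

theorem integrable_mul_indicator_half {F : ℝ → ℝ} (hF : Continuous F) :
    IntervalIntegrable (fun x => F x * (Iic (1 / 2 : ℝ)).indicator 1 x) volume 0 1 := by
  simp only [mul_indicator_half]
  rw [intervalIntegrable_iff]
  exact (intervalIntegrable_iff.1 (hF.intervalIntegrable 0 1)).indicator measurableSet_Iic

variable {a k : ℝ → ℝ} {U φ : ℝ → ℝ → ℝ}

theorem lintegral_ofReal_leb01 {G : ℝ → ℝ} (hG : IntervalIntegrable G volume 0 1)
    (h0 : ∀ x ∈ Icc (0 : ℝ) 1, 0 ≤ G x) :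
    ∫⁻ x in Icc (0 : ℝ) 1, ENNReal.ofReal (G x) = ENNReal.ofReal (∫ x in (0 : ℝ)..1, G x) := by
  rw [← integral_leb01, ofReal_integral_eq_lintegral_ofReal _ (ae_leb01 h0)]
  rwa [intervalIntegrable_iff_integrableOn_Icc_of_le zero_le_one] at hG

/-- The squared norm of the covector `flowP`. -/
noncomputable def flowK (a k : ℝ → ℝ) (U φ : ℝ → ℝ → ℝ) (s : ℝ) : ℝ :=
  ∫ x in (0 : ℝ)..1, Real.exp (U s x) * flowP a k φ s x ^ 2

namespace IsLandmarkFlow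

variable (h : IsLandmarkFlow a k U φ)
include h

theorem continuous_flowK : Continuous (flowK a k U φ) := by
  have hc : Continuous (Function.uncurry fun s x => Real.exp (U s x) * flowP a k φ s x ^ 2) :=
    h.continuous_exp_U.mul (h.continuous_flowP.pow 2)
  exact intervalIntegral.continuous_parametric_intervalIntegral_of_continuous' hc 0 1

/-- The projection of the field generated by a point mass at `1 / 2`. -/
theorem projStar_opUMeas (s : ℝ) {g : ℝ} (hg : 0 ≤ g) {x : ℝ} (hx : x ∈ Icc (0 : ℝ) 1) :
    projStar (geoQ a k U φ s) (opUMeas (ENNReal.ofReal g • Measure.dirac (1 / 2))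
      (geoQ a k U φ s)) x = (1 / 2) * g * Real.exp (U s (1 / 2)) *
        ((Iic (1 / 2 : ℝ)).indicator 1 x - 5 / 4 + 3 / 2 * φ s x) := by
  set κ : ℝ := (1 / 2) * g * Real.exp (U s (1 / 2))
  have hf : opUMeas (ENNReal.ofReal g • Measure.dirac (1 / 2)) (geoQ a k U φ s) =
      fun x => κ * (Iic (1 / 2 : ℝ)).indicator 1 x := by
    ext x
    rw [opUMeas_smul_dirac _ hg, h.eta_geoQ _ (by constructor <;> norm_num)]
  -- Since `φ` fixes 1/2, the moments of the indicator are `∫ dy` and `∫ y dy` over `[0, 1/2]`, that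
  -- is 1/2 and 1/8. The inverse Gram matrix turns them into `5/4 - (3/2) φ`.
  have e1 : innerEta (geoQ a k U φ s) ((Iic (1 / 2 : ℝ)).indicator 1) (fun _ => 1) = 1 / 2 := by
    rw [h.innerEta_geoQ (EventuallyEq.refl _ _) (fun _ _ => rfl)]
    simp only [mul_one]
    rw [integral_mul_indicator_half]
    have := h.integral_comp_phi (F := fun y => y) (F' := fun _ => 1)
      (fun y => hasDerivAt_id y) continuous_const s 0 (1 / 2)
    simp only [mul_one] at this
    rw [this, h.flow.phi_left, h.phi_half, sub_zero]
  have e2 : innerEta (geoQ a k U φ s) ((Iic (1 / 2 : ℝ)).indicator 1)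
      (phi (geoQ a k U φ s)) = 1 / 8 := by
    rw [h.innerEta_geoQ (EventuallyEq.refl _ _) (fun x hx => h.phi_geoQ s hx)]
    simp only [mul_right_comm _ (indicator _ _ _)]
    rw [integral_mul_indicator_half]
    have := h.integral_comp_phi (F := fun y => y ^ 2 / 2) (F' := fun y => y)
      (fun y => (((hasDerivAt_id y).fun_pow 2).div_const 2).congr_deriv
        (by push_cast; simp only [id]; ring)) continuous_id s 0 (1 / 2)
    rw [this, h.flow.phi_left, h.phi_half]
    norm_num
  rw [projStar, hf, innerEta_const_mul, innerEta_const_mul, e1, e2, gramComb_eq, h.phi_geoQ s hx]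
  ring

/-- The momentum is orthogonal to 1 and `φ`, so the projection drops out of the pairing and only
`∫₀^{1/2} η p = V'(1/2)` survives. This is where the defect sees the compression at the midpoint. -/
theorem integral_flowQ'_mul_proj (s : ℝ) :
    ∫ x in (0 : ℝ)..1, flowQ' a k U φ s x *
      ((Iic (1 / 2 : ℝ)).indicator 1 x - 5 / 4 + 3 / 2 * φ s x) = -decayRate a k s := by
  have c1 := slice_continuous h.continuous_flowQ' s
  have c2 := slice_continuous h.flow.continuous_phi s
  have e : ∀ x, flowQ' a k U φ s x *
      ((Iic (1 / 2 : ℝ)).indicator 1 x - 5 / 4 + 3 / 2 * φ s x) =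
      flowQ' a k U φ s x * (Iic (1 / 2 : ℝ)).indicator 1 x +
        (-(5 / 4) * flowQ' a k U φ s x + 3 / 2 * (flowQ' a k U φ s x * φ s x)) := fun x => by ring
  have z1 := h.integral_flowQ' s 1
  rw [h.flow.phi_right, fV1_one (h.a_pos s) (h.a_lt s)] at z1
  have z2 : ∫ x in (0 : ℝ)..1, flowQ' a k U φ s x * φ s x = 0 := h.integral_flowQ'_mul_phi s
  simp only [e]
  rw [intervalIntegral.integral_add (integrable_mul_indicator_half c1)
    (Continuous.intervalIntegrable (by fun_prop) _ _), intervalIntegral.integral_add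
    (Continuous.intervalIntegrable (by fun_prop) _ _)
    (Continuous.intervalIntegrable (by fun_prop) _ _), intervalIntegral.integral_const_mul,
    intervalIntegral.integral_const_mul, z1, z2, integral_mul_indicator_half, h.integral_flowQ',
    h.phi_half, fV1_half (h.a_lt s), decayRate]
  ring

/-- Spatial part of the relaxed energy, for a multiple `c` of the momentum as acceleration and a
point mass `g` at `1 / 2` as defect. -/
theorem lintegral_accel_le (s c : ℝ) {g : ℝ} (hg : 0 ≤ g) {f : ℝ → ℝ}
    (hf : ∀ᵐ x ∂leb01, f x = c * flowP a k φ s x) :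
    0 ≤ c ^ 2 * flowK a k U φ s - c * g * Real.exp (U s (1 / 2)) * decayRate a k s +
      (g * Real.exp (U s (1 / 2))) ^ 2 ∧
    ∫⁻ x in Icc (0 : ℝ) 1, ENNReal.ofReal (eta (geoQ a k U φ s) x * (f x +
      projStar (geoQ a k U φ s) (opUMeas (ENNReal.ofReal g • Measure.dirac (1 / 2))
        (geoQ a k U φ s)) x) ^ 2) ≤
    ENNReal.ofReal (c ^ 2 * flowK a k U φ s - c * g * Real.exp (U s (1 / 2)) * decayRate a k s +
      (g * Real.exp (U s (1 / 2))) ^ 2) := by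
  set E := Real.exp (U s (1 / 2))
  set B : ℝ → ℝ := fun x => (Iic (1 / 2 : ℝ)).indicator 1 x - 5 / 4 + 3 / 2 * φ s x with hB
  have cE := slice_continuous h.continuous_exp_U s
  have cP := slice_continuous h.continuous_flowP s
  have cφ := slice_continuous h.flow.continuous_phi s
  have cQ := slice_continuous h.continuous_flowQ' s
  -- The expanded square, with `B² / 4` in the quadratic term replaced by its crude bound 1. That
  -- term contributes only at second order in the defect.
  set G : ℝ → ℝ := fun x => c ^ 2 * (Real.exp (U s x) * flowP a k φ s x ^ 2) +
    (c * g * E) * (flowQ' a k U φ s x * B x) + (g * E) ^ 2 * Real.exp (U s x) with hG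
  have hBsq : ∀ x ∈ Icc (0 : ℝ) 1, B x ^ 2 ≤ 4 := fun x hx => by
    have h1 := h.flow.phi_mem s x hx
    have h2 : (Iic (1 / 2 : ℝ)).indicator (1 : ℝ → ℝ) x = 0 ∨
        (Iic (1 / 2 : ℝ)).indicator (1 : ℝ → ℝ) x = 1 := by
      by_cases hx : x ∈ Iic (1 / 2 : ℝ)
      · exact Or.inr (indicator_of_mem hx _)
      · exact Or.inl (indicator_of_notMem hx _)
    simp only [hB]
    rcases h2 with h2 | h2 <;> rw [h2] <;> nlinarith [h1.1, h1.2]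
  have hle : ∀ x ∈ Icc (0 : ℝ) 1,
      Real.exp (U s x) * (c * flowP a k φ s x + (1 / 2) * g * E * B x) ^ 2 ≤ G x := fun x hx => by
    have : 0 ≤ Real.exp (U s x) * (g * E) ^ 2 * (4 - B x ^ 2) :=
      mul_nonneg (by positivity) (by linarith [hBsq x hx])
    simp only [hG, flowQ']
    nlinarith
  have iQB : IntervalIntegrable (fun x => flowQ' a k U φ s x * B x) volume 0 1 := by
    have e : (fun x => flowQ' a k U φ s x * B x) = fun x =>
        flowQ' a k U φ s x * (Iic (1 / 2 : ℝ)).indicator 1 x +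
          flowQ' a k U φ s x * (3 / 2 * φ s x - 5 / 4) := by
      ext x; simp only [hB]; ring
    rw [e]
    exact (integrable_mul_indicator_half cQ).add
      (Continuous.intervalIntegrable (by fun_prop) _ _)
  have i1 : IntervalIntegrable (fun x => c ^ 2 * (Real.exp (U s x) * flowP a k φ s x ^ 2))
      volume 0 1 := Continuous.intervalIntegrable (by fun_prop) _ _
  have i3 : IntervalIntegrable (fun x => (g * E) ^ 2 * Real.exp (U s x)) volume 0 1 :=
    Continuous.intervalIntegrable (by fun_prop) _ _
  have iG : IntervalIntegrable G volume 0 1 := (i1.add (iQB.const_mul _)).add i3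
  have hη : ∫ x in (0 : ℝ)..1, Real.exp (U s x) = 1 := by
    rw [intervalIntegral.integral_eq_sub_of_hasDerivAt (fun x _ => h.flow.hasDerivAt_space s x)
      (cE.intervalIntegrable _ _), h.flow.phi_right, h.flow.phi_left, sub_zero]
  have hint : ∫ x in (0 : ℝ)..1, G x = c ^ 2 * flowK a k U φ s - c * g * E * decayRate a k s +
      (g * E) ^ 2 := by
    simp only [hG]
    rw [intervalIntegral.integral_add (i1.add (iQB.const_mul _)) i3,
      intervalIntegral.integral_add i1 (iQB.const_mul _), intervalIntegral.integral_const_mul,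
      intervalIntegral.integral_const_mul, intervalIntegral.integral_const_mul, hη,
      h.integral_flowQ'_mul_proj, flowK]
    ring
  have hG0 : ∀ x ∈ Icc (0 : ℝ) 1, 0 ≤ G x := fun x hx => le_trans (by positivity) (hle x hx)
  rw [← hint]
  refine ⟨intervalIntegral.integral_nonneg zero_le_one hG0, ?_⟩
  rw [← lintegral_ofReal_leb01 iG hG0]
  refine lintegral_mono_ae ?_
  filter_upwards [hf, ae_restrict_mem measurableSet_Icc] with x h1 hx
  rw [h1, h.eta_geoQ s hx, h.projStar_opUMeas s hg hx]
  exact ENNReal.ofReal_le_ofReal (hle x hx)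

theorem lintegral_accel_zero (s c : ℝ) {f : ℝ → ℝ}
    (hf : ∀ᵐ x ∂leb01, f x = c * flowP a k φ s x) :
    ∫⁻ x in Icc (0 : ℝ) 1, ENNReal.ofReal (eta (geoQ a k U φ s) x * (f x +
      projStar (geoQ a k U φ s) (opUMeas (ENNReal.ofReal 0 • Measure.dirac (1 / 2))
        (geoQ a k U φ s)) x) ^ 2) = ENNReal.ofReal (c ^ 2 * flowK a k U φ s) := by
  have cE := slice_continuous h.continuous_exp_U s
  have cP := slice_continuous h.continuous_flowP s
  rw [flowK, ← intervalIntegral.integral_const_mul,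
    ← lintegral_ofReal_leb01 (Continuous.intervalIntegrable (by fun_prop) _ _)
      fun x _ => by positivity]
  refine lintegral_congr_ae ?_
  filter_upwards [hf, ae_restrict_mem measurableSet_Icc] with x h1 hx
  rw [h1, h.eta_geoQ s hx, h.projStar_opUMeas s le_rfl hx]
  congr 1
  ring

/-- The first variation of the energy at `Δ = 0` is negative for a suitable time change. -/
theorem exists_expTime_neg : ∃ A > 0, ∃ l > 0, ∫ t in (0 : ℝ)..1,
    Real.exp (U (expTime A l t) (1 / 2)) * (expTime' A l t ^ 2 -
      l * expTime' A l t * decayRate a k (expTime A l t) * expTime A l t ^ 2) < 0 := by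
  set E : ℝ → ℝ := fun s => Real.exp (U s (1 / 2)) with hE
  have cE : Continuous E := h.continuous_exp_U.comp
    (by fun_prop : Continuous fun s : ℝ => (s, (1 / 2 : ℝ)))
  have hdE : ∀ s, HasDerivAt E (-decayRate a k s * E s) s := fun s =>
    (h.hasDerivAt_U_half s).exp.congr_deriv (mul_comm _ _)
  have hEpos : ∀ s, 0 < E s := fun s => Real.exp_pos _
  set J : ℝ := ∫ s in (0 : ℝ)..1, E s * s
  have hJ : 0 < J := intervalIntegral.intervalIntegral_pos_of_pos_on
    (Continuous.intervalIntegrable (by fun_prop) _ _) (fun s hs => mul_pos (hEpos s) hs.1)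
    zero_lt_one
  obtain ⟨c, hc, hU⟩ := h.exists_U_half_le
  -- The final budget is `J / 2` for the boundary term and `A R = J / 4` for the term with `A`,
  -- against a gain of at least `J`.
  obtain ⟨R, hR1, hR⟩ : ∃ R, 1 ≤ R ∧ E R * R ^ 2 < J / 2 := by
    have hlim := (Real.tendsto_pow_mul_exp_neg_atTop_nhds_zero 2).comp
      (tendsto_id.const_mul_atTop hc)
    have hev := hlim.eventually (gt_mem_nhds (show 0 < c ^ 2 * (J / 2) by positivity))
    obtain ⟨R, h1, h2⟩ := (hev.and (eventually_ge_atTop 1)).exists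
    refine ⟨R, h2, ?_⟩
    have h3 : E R ≤ Real.exp (-(c * R)) := Real.exp_le_exp.2 (hU R (by linarith))
    simp only [Function.comp_def, id, mul_pow, mul_assoc] at h1
    have h4 := lt_of_mul_lt_mul_left h1 (by positivity)
    calc E R * R ^ 2 ≤ Real.exp (-(c * R)) * R ^ 2 := by gcongr
      _ = R ^ 2 * Real.exp (-(c * R)) := mul_comm _ _
      _ < J / 2 := h4
  have hR0 : 0 < R := by linarith
  set A : ℝ := J / (4 * R) with hA
  have hA0 : 0 < A := by positivity
  -- This rate makes the time change end at `R`.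
  set l : ℝ := Real.log (1 + R / A)
  have hRA : 0 < R / A := by positivity
  have hl0 : 0 < l := Real.log_pos (by linarith)
  have hend : expTime A l 1 = R := by
    rw [expTime, mul_one, Real.exp_log (by linarith)]
    field_simp
    ring
  refine ⟨A, hA0, l, hl0, ?_⟩
  have ca := continuous_expTime A l
  have ca' := continuous_expTime' A l
  have cEA : Continuous fun r => E r * (A - r) := by fun_prop
  have cδ : Continuous (decayRate a k) := by
    have := h.continuous_a
    have := h.continuous_k
    unfold decayRate
    fun_prop
  -- The primitive comes from the substitution `s = α(t)`: the integrand becomes `l E(s) (s + A -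
  -- δ(s) s²)`, and `-δ E s² = (E s²)' - 2 E s`.
  have hprim : ∀ t, HasDerivAt (fun t => l * (E (expTime A l t) * expTime A l t ^ 2 +
      ∫ r in (0 : ℝ)..expTime A l t, E r * (A - r)))
      (E (expTime A l t) * (expTime' A l t ^ 2 -
        l * expTime' A l t * decayRate a k (expTime A l t) * expTime A l t ^ 2)) t := fun t => by
    have hα := hasDerivAt_expTime A l t
    have h1 := (hdE (expTime A l t)).comp t hα
    have h2 := (cEA.integral_hasStrictDerivAt 0 (expTime A l t)).hasDerivAt.comp t hα
    refine (((h1.fun_mul (hα.fun_pow 2)).fun_add h2).const_mul l).congr_deriv ?_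
    simp only [Function.comp_def, expTime']
    push_cast
    ring
  have hval := intervalIntegral.integral_eq_sub_of_hasDerivAt (a := 0) (b := 1)
    (fun t _ => hprim t) (Continuous.intervalIntegrable (by fun_prop) _ _)
  rw [hval, hend, expTime_zero]
  simp only [intervalIntegral.integral_same]
  have iE : ∀ x y, IntervalIntegrable (fun r => A * E r) volume x y := fun x y =>
    Continuous.intervalIntegrable (by fun_prop) _ _
  have iEr : ∀ x y, IntervalIntegrable (fun r => E r * r) volume x y := fun x y =>
    Continuous.intervalIntegrable (by fun_prop) _ _
  have hsplit : ∫ r in (0 : ℝ)..R, E r * (A - r) =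
      (∫ r in (0 : ℝ)..R, A * E r) - ∫ r in (0 : ℝ)..R, E r * r := by
    rw [← intervalIntegral.integral_sub (iE _ _) (iEr _ _)]
    exact intervalIntegral.integral_congr fun r _ => by ring
  have hE1 : ∀ s, 0 ≤ s → E s ≤ 1 := fun s hs =>
    Real.exp_le_one_iff.2 ((hU s hs).trans (neg_nonpos.2 (by positivity)))
  have hb1 : ∫ r in (0 : ℝ)..R, A * E r ≤ A * R := by
    have := intervalIntegral.integral_mono_on hR0.le (iE 0 R)
      (intervalIntegrable_const (c := A)) fun r hr => mul_le_of_le_one_right hA0.le (hE1 r hr.1)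
    simpa [mul_comm] using this
  have hb2 : J ≤ ∫ r in (0 : ℝ)..R, E r * r := by
    rw [← intervalIntegral.integral_add_adjacent_intervals (iEr 0 1) (iEr 1 R)]
    have : 0 ≤ ∫ r in (1 : ℝ)..R, E r * r := intervalIntegral.integral_nonneg hR1 fun r hr =>
      mul_nonneg (hEpos r).le (by linarith [hr.1])
    linarith
  have hAR : A * R = J / 4 := by rw [hA]; field_simp
  have : E R * R ^ 2 + ∫ r in (0 : ℝ)..R, E r * (A - r) < 0 := by
    rw [hsplit]; linarith
  have := mul_neg_of_pos_of_neg hl0 this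
  linarith

end IsLandmarkFlow

end Energy

end DiffSpline

namespace DiffSpline

/-! ### Comparison of the energies with and without defect. -/

section Main

variable {a k : ℝ → ℝ} {U φ : ℝ → ℝ → ℝ}

theorem flowK_nonneg (s : ℝ) : 0 ≤ flowK a k U φ s :=
  intervalIntegral.integral_nonneg zero_le_one fun x _ => by positivity

/-- The energy of the geodesic itself, without defect. -/
theorem IsLandmarkFlow.le_relaxedF_zero (h : IsLandmarkFlow a k U φ) (A l : ℝ) (P : L2 → L2 → ℝ) :
    ((ENNReal.ofReal (∫ t in (0 : ℝ)..1, (l * expTime' A l t) ^ 2 *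
      flowK a k U φ (expTime A l t)) : ℝ≥0∞) : EReal) +
        ((P (expTime' A l 1 • geoP a k φ (expTime A l 1)) (geoQ a k U φ (expTime A l 1)) : ℝ) :
          EReal) ≤
      relaxedF P (fun t => expTime' A l t • geoP a k φ (expTime A l t))
        (fun t => geoQ a k U φ (expTime A l t)) 0 := by
  rw [relaxedF]
  refine add_le_add_left (EReal.coe_ennreal_le_coe_ennreal_iff.2 ?_) _
  -- Only a lower bound is needed for the zero defect, so its Fisher-Rao term is dropped.
  refine le_trans (le_of_eq ?_) le_add_self
  have c1 := continuous_expTime A l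
  have c2 := continuous_expTime' A l
  have c3 := h.continuous_flowK
  -- The zero measure is treated as a line measure of density zero, so that its slices are given by
  -- `slice_lineMeas`.
  have hΔ : ((0 : FiniteMeasure (ℝ × ℝ)) : Measure (ℝ × ℝ)) = lineMeas fun _ => 0 := by
    simp [lineMeas, densMeas]
  rw [← lintegral_ofReal_leb01 (Continuous.intervalIntegrable (by fun_prop) _ _) fun t _ =>
    mul_nonneg (sq_nonneg _) (flowK_nonneg _)]
  refine lintegral_congr_ae ?_
  filter_upwards [slice_lineMeas continuous_const hΔ] with t ht
  rw [ht]
  exact (h.lintegral_accel_zero (expTime A l t) (l * expTime' A l t)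
    (h.accelFlat_reparam A l t)).symm

/-- A defect of density `ε α²` along the line `x = 1 / 2`, `α` being the time change. -/
noncomputable def defectDens (A l ε t : ℝ) : ℝ := ε * expTime A l t ^ 2

/-- The time derivative of `defectDens`. -/
noncomputable def defectDens' (A l ε t : ℝ) : ℝ := 2 * ε * expTime A l t * expTime' A l t

theorem hasDerivAt_defectDens (A l ε t : ℝ) :
    HasDerivAt (defectDens A l ε) (defectDens' A l ε t) t := by
  refine (((hasDerivAt_expTime A l t).fun_pow 2).const_mul ε).congr_deriv ?_
  rw [defectDens']
  push_cast
  ring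

theorem continuous_defectDens (A l ε : ℝ) : Continuous (defectDens A l ε) :=
  continuous_const.mul ((continuous_expTime A l).pow 2)

theorem continuous_defectDens' (A l ε : ℝ) : Continuous (defectDens' A l ε) :=
  (continuous_const.mul (continuous_expTime A l)).mul (continuous_expTime' A l)

/-- The density `ε α²` makes the Fisher-Rao integrand `ρ'² / (4 ρ)` equal to `ε α'²`, linear in `ε`.
The cross term with the acceleration is also linear in `ε`, and the two together form the first
variation. -/
theorem IsLandmarkFlow.relaxedF_defect_le (h : IsLandmarkFlow a k U φ) {A l ε : ℝ} (hA : 0 < A)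
    (hl : 0 < l) (hε : 0 < ε) (P : L2 → L2 → ℝ) : ∃ Δ ∈ M0, ∃ B : ℝ, 0 ≤ B ∧
    B = (∫ t in (0 : ℝ)..1, (l * expTime' A l t) ^ 2 * flowK a k U φ (expTime A l t)) +
      ε * (∫ t in (0 : ℝ)..1, Real.exp (U (expTime A l t) (1 / 2)) * (expTime' A l t ^ 2 -
        l * expTime' A l t * decayRate a k (expTime A l t) * expTime A l t ^ 2)) +
      ε ^ 2 * (∫ t in (0 : ℝ)..1,
        (expTime A l t ^ 2 * Real.exp (U (expTime A l t) (1 / 2))) ^ 2) ∧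
    relaxedF P (fun t => expTime' A l t • geoP a k φ (expTime A l t))
        (fun t => geoQ a k U φ (expTime A l t)) Δ ≤
      ((ENNReal.ofReal B : ℝ≥0∞) : EReal) +
        ((P (expTime' A l 1 • geoP a k φ (expTime A l 1)) (geoQ a k U φ (expTime A l 1)) : ℝ) :
          EReal) := by
  have c1 := continuous_expTime A l
  have c2 := continuous_expTime' A l
  have c3 := h.continuous_flowK
  have cE : Continuous fun s => Real.exp (U s (1 / 2)) := h.continuous_exp_U.comp
    (by fun_prop : Continuous fun s : ℝ => (s, (1 / 2 : ℝ)))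
  have cEA : Continuous fun t => Real.exp (U (expTime A l t) (1 / 2)) := cE.comp c1
  have cδ : Continuous (decayRate a k) := by
    have := h.continuous_a
    have := h.continuous_k
    unfold decayRate
    fun_prop
  have cρ := continuous_defectDens A l ε
  have cρ' := continuous_defectDens' A l ε
  have hα0 : ∀ t ∈ Icc (0 : ℝ) 1, 0 ≤ expTime A l t := fun t ht => expTime_nonneg hA hl ht.1
  have hα : ∀ t ∈ Ioc (0 : ℝ) 1, 0 < expTime A l t := fun t ht => by
    have : 1 < Real.exp (l * t) := Real.one_lt_exp_iff.2 (mul_pos hl ht.1)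
    exact mul_pos hA (by linarith)
  have h0 : ∀ t ∈ Icc (0 : ℝ) 1, 0 ≤ defectDens A l ε t := fun t _ => by
    rw [defectDens]; positivity
  have h0' : ∀ t ∈ Icc (0 : ℝ) 1, 0 ≤ defectDens' A l ε t := fun t ht => by
    have := hα0 t ht
    have := expTime'_pos hA hl t
    rw [defectDens']; positivity
  have hpos : ∀ t ∈ Ioc (0 : ℝ) 1, 0 < defectDens A l ε t := fun t ht => by
    have := hα t ht
    rw [defectDens]; positivity
  have := isFiniteMeasure_lineMeas cρ
  have := isFiniteMeasure_lineMeas cρ'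
  set Δ : FiniteMeasure (ℝ × ℝ) := ⟨lineMeas (defectDens A l ε), inferInstance⟩
  have hΔ : (Δ : Measure (ℝ × ℝ)) = lineMeas (defectDens A l ε) := rfl
  have htd : IsTimeDeriv (Δ : Measure (ℝ × ℝ)) (lineMeas (defectDens' A l ε)).toSignedMeasure :=
    isTimeDeriv_lineMeas (hasDerivAt_defectDens A l ε) cρ' h0 h0'
      (by rw [defectDens, expTime_zero]; ring)
  have iI : IntervalIntegrable (fun t => ε * (Real.exp (U (expTime A l t) (1 / 2)) *
      expTime' A l t ^ 2)) volume 0 1 := Continuous.intervalIntegrable (by fun_prop) _ _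
  have hFR : fisherRaoPath (fun t => geoQ a k U φ (expTime A l t)) Δ ≤
      ENNReal.ofReal (∫ t in (0 : ℝ)..1, ε * (Real.exp (U (expTime A l t) (1 / 2)) *
        expTime' A l t ^ 2)) := by
    refine (iInf₂_le _ htd).trans ((fisherRao_lineMeas_le cρ cρ' hpos h0 h0' cEA
      fun t _ => h.eta_geoQ _ (by constructor <;> norm_num)).trans ?_)
    rw [← lintegral_ofReal_leb01 iI fun t _ => by positivity]
    refine lintegral_mono_ae ?_
    have hne : ∀ᵐ t ∂leb01, t ≠ 0 := Measure.ae_ne _ _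
    filter_upwards [hne, ae_restrict_mem measurableSet_Icc] with t h1 h2
    have := hα t ⟨lt_of_le_of_ne h2.1 h1.symm, h2.2⟩
    refine ENNReal.ofReal_le_ofReal (le_of_eq ?_)
    rw [defectDens, defectDens']
    field_simp
    ring
  set T : ℝ → ℝ := fun t => (l * expTime' A l t) ^ 2 * flowK a k U φ (expTime A l t) -
    l * expTime' A l t * defectDens A l ε t * Real.exp (U (expTime A l t) (1 / 2)) *
      decayRate a k (expTime A l t) +
      (defectDens A l ε t * Real.exp (U (expTime A l t) (1 / 2))) ^ 2 with hT
  have cT : Continuous T := by fun_prop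
  have hT0 : ∀ t ∈ Icc (0 : ℝ) 1, 0 ≤ T t := fun t ht =>
    (h.lintegral_accel_le (expTime A l t) (l * expTime' A l t) (h0 t ht)
      (h.accelFlat_reparam A l t)).1
  have hacc : ∫⁻ t in Icc (0 : ℝ) 1, ∫⁻ x in Icc (0 : ℝ) 1,
      ENNReal.ofReal (eta (geoQ a k U φ (expTime A l t)) x *
        (accelFlat (expTime' A l t • geoP a k φ (expTime A l t)) (geoQ a k U φ (expTime A l t))
          (deriv (fun t => expTime' A l t • geoP a k φ (expTime A l t)) t) x +
        projStar (geoQ a k U φ (expTime A l t)) (opUMeas (slice Δ t)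
          (geoQ a k U φ (expTime A l t))) x) ^ 2) ≤
      ENNReal.ofReal (∫ t in (0 : ℝ)..1, T t) := by
    rw [← lintegral_ofReal_leb01 (Continuous.intervalIntegrable (by fun_prop) _ _)
      hT0]
    refine lintegral_mono_ae ?_
    filter_upwards [slice_lineMeas cρ hΔ, ae_restrict_mem measurableSet_Icc] with t ht hm
    rw [ht]
    exact (h.lintegral_accel_le (expTime A l t) (l * expTime' A l t) (h0 t hm)
      (h.accelFlat_reparam A l t)).2
  have hI0 : 0 ≤ ∫ t in (0 : ℝ)..1, ε * (Real.exp (U (expTime A l t) (1 / 2)) *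
      expTime' A l t ^ 2) := intervalIntegral.integral_nonneg zero_le_one fun t _ => by positivity
  have hTi : 0 ≤ ∫ t in (0 : ℝ)..1, T t := intervalIntegral.integral_nonneg zero_le_one hT0
  refine ⟨Δ, ⟨lineMeas_compl_D, _, htd⟩, _, add_nonneg hI0 hTi, ?_, ?_⟩
  · rw [← intervalIntegral.integral_add iI (cT.intervalIntegrable _ _),
      ← intervalIntegral.integral_const_mul, ← intervalIntegral.integral_const_mul,
      ← intervalIntegral.integral_add (Continuous.intervalIntegrable (by fun_prop) _ _)
        (Continuous.intervalIntegrable (by fun_prop) _ _),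
      ← intervalIntegral.integral_add (Continuous.intervalIntegrable (by fun_prop) _ _)
        (Continuous.intervalIntegrable (by fun_prop) _ _)]
    refine intervalIntegral.integral_congr fun t _ => ?_
    simp only [hT, defectDens]
    ring
  · rw [relaxedF, ENNReal.ofReal_add hI0 hTi]
    exact add_le_add_left (EReal.coe_ennreal_le_coe_ennreal_iff.2 (add_le_add hFR hacc)) _

theorem IsLandmarkFlow.not_isMinOn (h : IsLandmarkFlow a k U φ) {A l : ℝ} (hA : 0 < A)
    (hl : 0 < l) (hneg : ∫ t in (0 : ℝ)..1,
      Real.exp (U (expTime A l t) (1 / 2)) * (expTime' A l t ^ 2 -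
        l * expTime' A l t * decayRate a k (expTime A l t) * expTime A l t ^ 2) < 0)
    (P : L2 → L2 → ℝ) :
    ¬ IsMinOn (relaxedF P (fun t => expTime' A l t • geoP a k φ (expTime A l t))
      (fun t => geoQ a k U φ (expTime A l t))) M0 0 := by
  set I := ∫ t in (0 : ℝ)..1, Real.exp (U (expTime A l t) (1 / 2)) * (expTime' A l t ^ 2 -
    l * expTime' A l t * decayRate a k (expTime A l t) * expTime A l t ^ 2)
  set J := ∫ t in (0 : ℝ)..1, (expTime A l t ^ 2 * Real.exp (U (expTime A l t) (1 / 2))) ^ 2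
    with hJ
  have hJ0 : 0 ≤ J := intervalIntegral.integral_nonneg zero_le_one fun t _ => sq_nonneg _
  obtain ⟨ε, hε, hlt⟩ : ∃ ε > 0, ε * I + ε ^ 2 * J < 0 := by
    -- This choice gives the value `-(I / (J + 1))²`; the summand 1 avoids a separate case `J = 0`.
    refine ⟨-I / (J + 1), div_pos (neg_pos.2 hneg) (by positivity), ?_⟩
    have : -I / (J + 1) * I + (-I / (J + 1)) ^ 2 * J = -(I / (J + 1)) ^ 2 := by
      field_simp
      ring
    rw [this, neg_lt_zero]
    have : I / (J + 1) ≠ 0 := div_ne_zero hneg.ne (by positivity)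
    positivity
  obtain ⟨Δ, hΔ, B, hB0, hB, hle⟩ := h.relaxedF_defect_le hA hl hε P
  intro hmin
  refine absurd ((isMinOn_iff.1 hmin) Δ hΔ) (not_le.2 (hle.trans_lt ?_))
  refine lt_of_lt_of_le ?_ (h.le_relaxedF_zero A l P)
  refine EReal.add_lt_add_right_coe (EReal.coe_ennreal_lt_coe_ennreal_iff.2 ?_) _
  have : B < ∫ t in (0 : ℝ)..1, (l * expTime' A l t) ^ 2 * flowK a k U φ (expTime A l t) := by
    linarith
  exact (ENNReal.ofReal_lt_ofReal_iff (hB0.trans_lt this)).2 this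

end Main

end DiffSpline
theorem mainTheorem5 :
    ∃ p₀ q₀ : ℝ → DiffSpline.L2,
      DiffSpline.IsLandmarkGeodesic ![1, -1] ![1 / 4, 3 / 4] p₀ q₀ ∧
      StrictAntiOn (fun t => DiffSpline.eta (q₀ t) (1 / 2)) (Set.Ici 0) ∧
      Filter.Tendsto (fun t => DiffSpline.eta (q₀ t) (1 / 2)) Filter.atTop (nhds 0) ∧
      ∃ α : ℝ → ℝ, DiffSpline.IsTimeReparam α ∧
        ∃ p q : ℝ → DiffSpline.L2,
          (∀ t, p t = deriv α t • p₀ (α t)) ∧ (∀ t, q t = q₀ (α t)) ∧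
          DiffSpline.IsCurve (p 0) (q 0) p q ∧
          ∀ P : DiffSpline.L2 → DiffSpline.L2 → ℝ,
            ¬ IsMinOn (DiffSpline.relaxedF P p q) DiffSpline.M0 0 := by
  obtain ⟨a, k, U, φ, h⟩ := DiffSpline.exists_isLandmarkFlow
  obtain ⟨A, hA, l, hl, hneg⟩ := h.exists_expTime_neg
  exact ⟨DiffSpline.geoP a k φ, DiffSpline.geoQ a k U φ, h.isLandmarkGeodesic,
    h.strictAntiOn_eta_half, h.tendsto_eta_half, DiffSpline.expTime A l,
    DiffSpline.isTimeReparam_expTime hA hl,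
    fun t => DiffSpline.expTime' A l t • DiffSpline.geoP a k φ (DiffSpline.expTime A l t),
    fun t => DiffSpline.geoQ a k U φ (DiffSpline.expTime A l t),
    fun t => by rw [DiffSpline.deriv_expTime], fun t => rfl, h.isCurve_reparam A l,
    h.not_isMinOn hA hl hneg⟩
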